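/- Let $N\ge 0$, and let $\mathcal A=\{1,\dots,N\}\sqcup\{\bar 1,\dots,\bar N\}$ be the alphabet of unbarred and barred letters; words in $\mathcal A$ are called colored words. A shuffle order is a total order $\lessdot$ on $\mathcal A$ with $1\lessdot\cdots\lessdot N$ and $\bar 1\lessdot\cdots\lessdot\bar N$; in particular we have the natural order $1<\bar 1<2<\bar 2<\cdots<N<\bar N$ and the big bar order $1\prec 2\prec\cdots\prec N\prec\bar 1\prec\bar 2\prec\cdots\prec\bar N$. Let $\mathcal U$ be the free associative $\mathbb Z$-algebra on $\mathcal A$, with the colored words as its basis of monomials. For $x\in\mathcal A$, let $x{\Downarrow}$ be the letter immediately below $x$ in the natural order ($1{\Downarrow}$ is undefined). Let $I_{\mathrm{kron}}\subseteq\mathcal U$ be the two-sided ideal corresponding to the relations $$yyx=yxy\ \ (y\text{ unbarred},\,x<y),\qquad zyy=yzy\ \ (y\text{ unbarred},\,y<z),$$ $$yyz=yzy\ \ (y\text{ barred},\,y<z),\qquad xyy=yxy\ \ (y\text{ barred},\,x<y),$$ $$(xz-zx)y=y(xz-zx)\ \ (x=y{\Downarrow}=z{\Downarrow}{\Downarrow}),\qquad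 xz=zx\ \ (x<z{\Downarrow}{\Downarrow}),$$ and let $(I_{\mathrm{kron}})^\perp$ be its orthogonal complement, in the (possibly infinite) formal sums of colored words, for the pairing under which colored words are orthonormal. A set $W$ of colored words is shuffle closed if for every $w\in W$, each word obtained from $w$ by swapping a barred letter with an adjacent unbarred letter also lies in $W$. For a partition $\nu$ and a shuffle order $\lessdot$, let $CT^{\lessdot}_\nu$ be the set of $\lessdot$-colored tableaux of shape $\nu$: fillings of the diagram of $\nu$ (English notation) by $\mathcal A$ whose rows and columns weakly increase for $\lessdot$, while the unbarred letters in each column and the barred letters in each row strictly increase. For such a filling $T$, the word $\mathrm{sqread}(T)$ is obtained by going through the diagonals of $T$ starting from the southwest, reading in each diagonal first the unbarred entries from southeast to northwest and then the barred entries from northwest to southeast. Conversion: if $\lessdot$ and $\lessdot'$ are shuffle orders that are identical except for the order of one unbarred letter $b$ and one barred letter $\bar a$, a $\lessdot$-colored tableau $T$ is converted to the $\lessdot'$-colored tableau obtained by refilling each connected component of the set of boxes containing $b$ or $\bar a$ with the same number of $b$'s and the same number of $\bar a$'s. For arbitrary shuffle orders $\lessdot,\lessdot'$, conversion is the iteration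 of this process along a sequence of such swaps leading from $\lessdot$ to $\lessdot'$. **Theorem.** Let $W$ be a shuffle closed set of colored words such that $\sum_{w\in W}w\in(I_{\mathrm{kron}})^\perp$, and let $\nu$ be a partition. Conversion from $\prec$ to $<$ is well defined: every $T\in CT^{\prec}_\nu$ can be converted along some sequence of swaps, and the resulting tableau $T^{\prec\to<}$ does not depend on the sequence of swaps. Moreover, $$\{T^{\prec\to<}\mid T\in CT^{\prec}_\nu,\ \mathrm{sqread}(T)\in W\}=\{T\in CT^{<}_\nu\mid \mathrm{sqread}(T)\in W\}.$$ -/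

import Mathlib

namespace ColoredTableaux

/-- The alphabet `𝒜 = {1, …, N} ⊔ {1̄, …, N̄}`. The element `a : Fin N` stands for the
number `a + 1`. -/
inductive Letter (N : ℕ) where
  | unbarred (a : Fin N) : Letter N
  | barred (a : Fin N) : Letter N
  deriving DecidableEq

/-- Whether a letter is barred. -/
def Letter.isBarred {N : ℕ} : Letter N → Bool
  | .unbarred _ => false
  | .barred _ => true

/-- Colored words. -/
abbrev Word (N : ℕ) : Type := List (Letter N)

/-! ### Shuffle orders -/

/-- A shuffle order: a (strict) total order on the alphabet with `1 ⋖ 2 ⋖ ⋯ ⋖ N` and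
`1̄ ⋖ 2̄ ⋖ ⋯ ⋖ N̄`. -/
@[ext]
structure ShuffleOrder (N : ℕ) where
  lt : Letter N → Letter N → Prop
  total : IsStrictTotalOrder (Letter N) lt
  unbarred_lt : ∀ a b : Fin N, a < b → lt (.unbarred a) (.unbarred b)
  barred_lt : ∀ a b : Fin N, a < b → lt (.barred a) (.barred b)

/-- Positions in `1 < 1̄ < 2 < 2̄ < ⋯ < N < N̄`. -/
def natRank {N : ℕ} : Letter N → ℕ
  | .unbarred a => 2 * a.val
  | .barred a => 2 * a.val + 1

/-- Positions in `1 ≺ 2 ≺ ⋯ ≺ N ≺ 1̄ ≺ 2̄ ≺ ⋯ ≺ N̄`. -/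
def bigBarRank {N : ℕ} : Letter N → ℕ
  | .unbarred a => a.val
  | .barred a => N + a.val

theorem natRank_injective {N : ℕ} : Function.Injective (natRank (N := N)) := by
  rintro (a | a) (b | b) h <;> simp only [natRank] at h
  · exact congrArg _ (Fin.ext (by omega))
  · omega
  · omega
  · exact congrArg _ (Fin.ext (by omega))

theorem bigBarRank_injective {N : ℕ} : Function.Injective (bigBarRank (N := N)) := by
  rintro (a | a) (b | b) h <;> simp only [bigBarRank] at h
  · exact congrArg _ (Fin.ext (by omega))
  · have := a.isLt
    omega
  · have := b.isLt
    omega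
  · exact congrArg _ (Fin.ext (by omega))

theorem isStrictTotalOrder_of_rank {N : ℕ} {r : Letter N → ℕ} (hr : Function.Injective r) :
    IsStrictTotalOrder (Letter N) (fun x y => r x < r y) where
  trichotomous _ _ h h' := hr (le_antisymm (not_lt.mp h') (not_lt.mp h))
  irrefl x := lt_irrefl (r x)
  trans _ _ _ h h' := lt_trans h h'

/-- The natural order `1 < 1̄ < 2 < 2̄ < ⋯ < N < N̄`. -/
def natOrder (N : ℕ) : ShuffleOrder N where
  lt x y := natRank x < natRank y
  total := isStrictTotalOrder_of_rank natRank_injective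
  unbarred_lt a b h := by
    have : a.val < b.val := h
    simp only [natRank]
    omega
  barred_lt a b h := by
    have : a.val < b.val := h
    simp only [natRank]
    omega

/-- The big bar order `1 ≺ 2 ≺ ⋯ ≺ N ≺ 1̄ ≺ 2̄ ≺ ⋯ ≺ N̄`. -/
def bigBarOrder (N : ℕ) : ShuffleOrder N where
  lt x y := bigBarRank x < bigBarRank y
  total := isStrictTotalOrder_of_rank bigBarRank_injective
  unbarred_lt a b h := by
    have : a.val < b.val := h
    simp only [bigBarRank]
    omega
  barred_lt a b h := by
    have : a.val < b.val := h
    simp only [bigBarRank]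
    omega

/-! ### The free algebra, the ideal of Kronecker relations, and orthogonality -/

/-- The free associative `ℤ`-algebra on the noncommuting variables `u_x`, `x ∈ 𝒜`,
with the colored words as its basis of monomials. -/
abbrev U (N : ℕ) : Type := MonoidAlgebra ℤ (FreeMonoid (Letter N))

/-- The variable `u_x`. -/
noncomputable def u {N : ℕ} (x : Letter N) : U N :=
  MonoidAlgebra.of ℤ (FreeMonoid (Letter N)) (FreeMonoid.of x)

/-- Going down by one in the natural order; undefined at the smallest letter `1`. -/
def down {N : ℕ} : Letter N → Option (Letter N)
  | .unbarred a => if a.val = 0 then none else some (.barred ⟨a.val - 1, by omega⟩)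
  | .barred a => some (.unbarred a)

/-- Going down by two in the natural order, where defined. -/
def down₂ {N : ℕ} (x : Letter N) : Option (Letter N) := (down x).bind down

/-- `KronRelator f`: the element `f` of the free algebra is the difference of the two sides of one
of the defining relations of the ideal `I_kron`. -/
inductive KronRelator {N : ℕ} : U N → Prop
  /-- `yyx = yxy` for `y` unbarred, `x < y`. -/
  | yyx (x y : Letter N) (hy : y.isBarred = false) (h : (natOrder N).lt x y) :
      KronRelator (u y * u y * u x - u y * u x * u y)
  /-- `zyy = yzy` for `y` unbarred, `y < z`. -/
  | zyy (y z : Letter N) (hy : y.isBarred = false) (h : (natOrder N).lt y z) :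
      KronRelator (u z * u y * u y - u y * u z * u y)
  /-- `yyz = yzy` for `y` barred, `y < z`. -/
  | yyz (y z : Letter N) (hy : y.isBarred = true) (h : (natOrder N).lt y z) :
      KronRelator (u y * u y * u z - u y * u z * u y)
  /-- `xyy = yxy` for `y` barred, `x < y`. -/
  | xyy (x y : Letter N) (hy : y.isBarred = true) (h : (natOrder N).lt x y) :
      KronRelator (u x * u y * u y - u y * u x * u y)
  /-- `(xz - zx)y = y(xz - zx)` for `x = y⇓ = z⇓⇓`. -/
  | rotate (x y z : Letter N) (hy : down y = some x) (hz : down₂ z = some x) :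
      KronRelator ((u x * u z - u z * u x) * u y - u y * (u x * u z - u z * u x))
  /-- `xz = zx` for `x < z⇓⇓`. -/
  | farCommute (x z z' : Letter N) (hz : down₂ z = some z') (h : (natOrder N).lt x z') :
      KronRelator (u x * u z - u z * u x)

/-- The two-sided ideal `I_kron` of `U`. -/
noncomputable def Ikron (N : ℕ) : TwoSidedIdeal (U N) := TwoSidedIdeal.span {f | KronRelator f}

/-- The pairing of a formal sum `∑ γ_w w` of colored words with an element of `U`, for which the
colored words are orthonormal. The formal sum may be infinite, since elements of `U` are finite
linear combinations of words; for finite sums this is the symmetric bilinear form on `U`. -/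
def pairing {N : ℕ} (γ : Word N → ℤ) (f : U N) : ℤ :=
  f.coeff.sum fun w c => γ w.toList * c

/-- The orthogonal complement `I^⊥` of a two-sided ideal, in the formal sums of colored words. -/
def perp {N : ℕ} (I : TwoSidedIdeal (U N)) : Set (Word N → ℤ) :=
  {γ | ∀ f ∈ I, pairing γ f = 0}

/-- The formal sum `∑_{w ∈ W} w`. -/
noncomputable def indicatorSum {N : ℕ} (W : Set (Word N)) : Word N → ℤ :=
  W.indicator 1

/-- `W` is closed under swapping a barred letter with an adjacent unbarred letter. -/
def ShuffleClosed {N : ℕ} (W : Set (Word N)) : Prop :=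
  ∀ (p s : Word N) (x y : Letter N), x.isBarred ≠ y.isBarred →
    p ++ [x, y] ++ s ∈ W → p ++ [y, x] ++ s ∈ W

/-! ### Colored tableaux -/

/-- Fillings of the diagram of `ν` (English convention: a box is `(row, column)`, numbered from 0)
by letters. -/
abbrev Filling (N : ℕ) (ν : YoungDiagram) : Type := ν → Letter N

/-- A filling is a `⋖`-colored tableau if rows and columns weakly increase for `⋖`, while
the unbarred letters in each column and the barred letters in each row strictly increase. -/
structure IsColored {N : ℕ} (o : ShuffleOrder N) {ν : YoungDiagram} (T : Filling N ν) : Prop where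
  row_weak : ∀ c c' : ν, c.1.1 = c'.1.1 → c.1.2 < c'.1.2 → T c = T c' ∨ o.lt (T c) (T c')
  col_weak : ∀ c c' : ν, c.1.2 = c'.1.2 → c.1.1 < c'.1.1 → T c = T c' ∨ o.lt (T c) (T c')
  row_strict : ∀ c c' : ν, c.1.1 = c'.1.1 → c.1.2 < c'.1.2 → (T c).isBarred = true → T c ≠ T c'
  col_strict : ∀ c c' : ν, c.1.2 = c'.1.2 → c.1.1 < c'.1.1 → (T c).isBarred = false → T c ≠ T c'

/-- The set `CT_ν^⋖` of `⋖`-colored tableaux of shape `ν`. -/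
def CT {N : ℕ} (o : ShuffleOrder N) (ν : YoungDiagram) : Set (Filling N ν) :=
  {T | IsColored o T}

/-! ### The reading word -/

/-- The boxes `(i, j)` of `ν` on the diagonal `j - i = k - ℓ`, where `ℓ` is the number of rows
of `ν`, listed from northwest to southeast. -/
def diagonal (ν : YoungDiagram) (k : ℕ) : List ν :=
  (List.range (ν.colLen 0) ×ˢ List.range (ν.rowLen 0)).filterMap fun c =>
    if h : c ∈ ν ∧ c.2 + ν.colLen 0 = c.1 + k then some ⟨c, h.1⟩ else none

/-- The unbarred letters of a diagonal read from southeast to northwest, followed by its barred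
letters read from northwest to southeast. -/
def diagonalWord {N : ℕ} {ν : YoungDiagram} (T : Filling N ν) (k : ℕ) : Word N :=
  ((diagonal ν k).reverse.map T).filter (fun x => !x.isBarred) ++
    ((diagonal ν k).map T).filter (fun x => x.isBarred)

/-- The reading word `sqread(T)`: the concatenation of the diagonal words, starting from
the southwest. -/
def sqread {N : ℕ} {ν : YoungDiagram} (T : Filling N ν) : Word N :=
  (List.range (ν.colLen 0 + ν.rowLen 0)).flatMap (diagonalWord T)

/-! ### Conversion -/

/-- `o` and `o'` are identical except for the order of the two letters `b` and `ā`, with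
`b` below `ā` for `o` and `ā` below `b` for `o'`. -/
def DifferBySwap {N : ℕ} (o o' : ShuffleOrder N) (b a : Fin N) : Prop :=
  o.lt (.unbarred b) (.barred a) ∧ o'.lt (.barred a) (.unbarred b) ∧
    ∀ x y : Letter N, ¬ (x = .unbarred b ∧ y = .barred a) → ¬ (x = .barred a ∧ y = .unbarred b) →
      (o.lt x y ↔ o'.lt x y)

/-- Two boxes share an edge. -/
def BoxAdj (c c' : ℕ × ℕ) : Prop :=
  (c.1 = c'.1 ∧ (c.2 + 1 = c'.2 ∨ c'.2 + 1 = c.2)) ∨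
    (c.2 = c'.2 ∧ (c.1 + 1 = c'.1 ∨ c'.1 + 1 = c.1))

/-- The set of boxes of `T` filled with `b` or `ā`. -/
def ribbon {N : ℕ} {ν : YoungDiagram} (T : Filling N ν) (b a : Fin N) : Set ν :=
  {c | T c = .unbarred b ∨ T c = .barred a}

/-- The connected component of the box `c` in a set `R` of boxes. -/
def component {ν : YoungDiagram} (R : Set ν) (c : ν) : Set ν :=
  {c' | Relation.ReflTransGen (fun d d' : ν => d ∈ R ∧ d' ∈ R ∧ BoxAdj d.1 d'.1) c c'}

/-- `T'` arises from `T` by refilling each connected component of the set of boxes containing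
`b` or `ā` with the same number of letters `b` and the same number of letters `ā`. -/
def Refills {N : ℕ} {ν : YoungDiagram} (b a : Fin N) (T T' : Filling N ν) : Prop :=
  (∀ c, c ∉ ribbon T b a → T' c = T c) ∧
  ∀ c, c ∈ ribbon T b a →
    {d ∈ component (ribbon T b a) c | T' d = .unbarred b}.ncard =
      {d ∈ component (ribbon T b a) c | T d = .unbarred b}.ncard ∧
    {d ∈ component (ribbon T b a) c | T' d = .barred a}.ncard =
      {d ∈ component (ribbon T b a) c | T d = .barred a}.ncard

/-- A single step of conversion: from an `o`-colored tableau to an `o'`-colored tableau, where the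
orders `o` and `o'` differ by swapping one unbarred letter with one barred letter
(in either direction). -/
def ConvertStep {N : ℕ} {ν : YoungDiagram} (p q : ShuffleOrder N × Filling N ν) : Prop :=
  ∃ b a : Fin N, (DifferBySwap p.1 q.1 b a ∨ DifferBySwap q.1 p.1 b a) ∧
    IsColored p.1 p.2 ∧ IsColored q.1 q.2 ∧ Refills b a p.2 q.2

/-- `ConvertsTo o o' T T'`: the filling `T'` is obtained from `T` by conversion along some sequence
of swaps of consecutive letters leading from the order `o` to the order `o'`. -/
def ConvertsTo {N : ℕ} {ν : YoungDiagram} (o o' : ShuffleOrder N) (T T' : Filling N ν) : Prop :=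
  Relation.ReflTransGen ConvertStep (o, T) (o', T')

end ColoredTableaux

/-
Membership of a word in `W` only depends on its class in the syntactic monoid of `W`. There the
barred letters commute with the unbarred ones, and the unbarred (respectively barred) letters
satisfy plactic relations between neighbours and commute when they are not neighbours. Hence it
is enough to follow, separately, the products of the unbarred and of the barred letters of
`sqread T` along conversion.

A swap of `b ⋖ ā` moves the letters `b` within ribbons. Using the plactic relations, the product of
the unbarred letters of `sqread T` becomes the product of the unbarred parts of the rows of `T`,
from bottom to top, and this product survives the swap if no other barred letter lies next to `b`.
The natural order can be reached from the big bar order by swaps of this kind, and transposing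
the tableau handles the barred letters in the same way, along another sequence of swaps. The two
sequences lead to the same tableau because conversion is confluent: different swaps that
are possible for the same order involve disjoint pairs of letters, so they commute.
-/

namespace ColoredTableaux

open Relation MulOpposite

section ShuffleOrders

variable {N : ℕ}

instance : Finite (Letter N) :=
  Finite.of_surjective (Sum.elim Letter.unbarred Letter.barred : Fin N ⊕ Fin N → Letter N) <| by
    rintro (a | a)
    exacts [⟨.inl a, rfl⟩, ⟨.inr a, rfl⟩]

/-- Exchange barred and unbarred letters. -/
def Letter.flip : Letter N → Letter N
  | .unbarred a => .barred a
  | .barred a => .unbarred a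

@[simp] theorem Letter.flip_unbarred (a : Fin N) : (Letter.unbarred a).flip = .barred a := rfl

@[simp] theorem Letter.flip_barred (a : Fin N) : (Letter.barred a).flip = .unbarred a := rfl

@[simp] theorem Letter.flip_flip (x : Letter N) : x.flip.flip = x := by cases x <;> rfl

@[simp] theorem Letter.isBarred_flip (x : Letter N) : x.flip.isBarred = !x.isBarred := by
  cases x <;> rfl

theorem Letter.flip_involutive : Function.Involutive (Letter.flip (N := N)) := Letter.flip_flip

namespace ShuffleOrder

theorem irrefl (o : ShuffleOrder N) (x : Letter N) : ¬ o.lt x x := o.total.irrefl x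

theorem trans (o : ShuffleOrder N) {x y z : Letter N} (h : o.lt x y) (h' : o.lt y z) : o.lt x z :=
  o.total.trans _ _ _ h h'

theorem asymm (o : ShuffleOrder N) {x y : Letter N} (h : o.lt x y) : ¬ o.lt y x :=
  fun h' => o.irrefl _ (o.trans h h')

theorem lt_or_gt (o : ShuffleOrder N) {x y : Letter N} (h : x ≠ y) : o.lt x y ∨ o.lt y x := by
  by_contra hn
  rw [not_or] at hn
  exact h (o.total.trichotomous _ _ hn.1 hn.2)

/-- The number of letters below a given one. It embeds a shuffle order into `ℕ`. -/
noncomputable def rank (o : ShuffleOrder N) (x : Letter N) : ℕ := {y | o.lt y x}.ncard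

theorem rank_lt_rank (o : ShuffleOrder N) {x y : Letter N} (h : o.lt x y) :
    o.rank x < o.rank y :=
  Set.ncard_lt_ncard ⟨fun _ hz => o.trans hz h, fun hs => o.irrefl x (hs h)⟩ (Set.toFinite _)

theorem lt_iff_rank_lt (o : ShuffleOrder N) {x y : Letter N} :
    o.lt x y ↔ o.rank x < o.rank y := by
  refine ⟨o.rank_lt_rank, fun h => (o.lt_or_gt ?_).resolve_right fun h' => ?_⟩
  · rintro rfl
    exact lt_irrefl _ h
  · exact (o.rank_lt_rank h').asymm h

theorem unbarred_lt_unbarred (o : ShuffleOrder N) {a b : Fin N} :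
    o.lt (.unbarred a) (.unbarred b) ↔ a < b := by
  refine ⟨fun h => lt_of_not_ge fun hba => ?_, o.unbarred_lt a b⟩
  rcases hba.lt_or_eq with h' | rfl
  exacts [o.asymm h (o.unbarred_lt _ _ h'), o.irrefl _ h]

theorem barred_lt_barred (o : ShuffleOrder N) {a b : Fin N} :
    o.lt (.barred a) (.barred b) ↔ a < b := by
  refine ⟨fun h => lt_of_not_ge fun hba => ?_, o.barred_lt a b⟩
  rcases hba.lt_or_eq with h' | rfl
  exacts [o.asymm h (o.barred_lt _ _ h'), o.irrefl _ h]

theorem barred_lt_unbarred (o : ShuffleOrder N) {b a : Fin N} :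
    o.lt (.barred a) (.unbarred b) ↔ ¬ o.lt (.unbarred b) (.barred a) :=
  ⟨fun h => o.asymm h, (o.lt_or_gt (by simp)).resolve_left⟩

theorem unbarred_lt_barred_mono (o : ShuffleOrder N) {b b' a a' : Fin N} (hb : b' ≤ b)
    (ha : a ≤ a') (h : o.lt (.unbarred b) (.barred a)) : o.lt (.unbarred b') (.barred a') := by
  have h' : o.lt (.unbarred b') (.barred a) := by
    rcases hb.lt_or_eq with hb | rfl
    exacts [o.trans (o.unbarred_lt _ _ hb) h, h]
  rcases ha.lt_or_eq with ha | rfl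
  exacts [o.trans h' (o.barred_lt _ _ ha), h']

theorem ext_of_mixed {o o' : ShuffleOrder N}
    (h : ∀ b a, o.lt (.unbarred b) (.barred a) ↔ o'.lt (.unbarred b) (.barred a)) : o = o' := by
  ext (x | x) (y | y)
  · rw [o.unbarred_lt_unbarred, o'.unbarred_lt_unbarred]
  · exact h x y
  · rw [o.barred_lt_unbarred, o'.barred_lt_unbarred, h]
  · rw [o.barred_lt_barred, o'.barred_lt_barred]

/-- The shuffle order in which `b ⋖ ā` holds exactly when `t b a` does. -/
def ofTable (t : Fin N → Fin N → Prop)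
    (ht : ∀ {b b' a a'}, b' ≤ b → a ≤ a' → t b a → t b' a') : ShuffleOrder N where
  lt
    | .unbarred b, .unbarred b' => b < b'
    | .unbarred b, .barred a => t b a
    | .barred a, .unbarred b => ¬ t b a
    | .barred a, .barred a' => a < a'
  total :=
    { trichotomous := by rintro (x | x) (y | y) <;> grind
      irrefl := by rintro (x | x) <;> simp
      trans := by
        rintro (x | x) (y | y) (z | z) h h'
        · exact h.trans h'
        · exact ht h.le le_rfl h'
        · exact lt_of_not_ge fun hzx => h' (ht hzx le_rfl h)
        · exact ht le_rfl h'.le h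
        · exact fun hz => h (ht h'.le le_rfl hz)
        · exact lt_of_not_ge fun hzx => h (ht le_rfl hzx h')
        · exact fun hz => h' (ht le_rfl h.le hz)
        · exact h.trans h' }
  unbarred_lt _ _ h := h
  barred_lt _ _ h := h

/-- The order obtained by exchanging barred and unbarred letters. -/
def flip (o : ShuffleOrder N) : ShuffleOrder N where
  lt x y := o.lt x.flip y.flip
  total :=
    { trichotomous := fun _ _ h h' =>
        Letter.flip_involutive.injective (o.total.trichotomous _ _ h h')
      irrefl := fun _ => o.irrefl _
      trans := fun _ _ _ => o.trans }
  unbarred_lt := o.barred_lt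
  barred_lt := o.unbarred_lt

theorem flip_lt (o : ShuffleOrder N) {x y : Letter N} :
    o.flip.lt x y ↔ o.lt x.flip y.flip := Iff.rfl

@[simp] theorem flip_flip (o : ShuffleOrder N) : o.flip.flip = o := by
  ext x y
  simp [flip_lt]

/-- The order obtained by reversing `o` and renaming the letters `b` and `ā` to the bar of
`N + 1 - b` and to `N + 1 - a`. -/
def dual (o : ShuffleOrder N) : ShuffleOrder N :=
  ofTable (fun b a => o.lt (.unbarred a.rev) (.barred b.rev)) fun hb ha =>
    o.unbarred_lt_barred_mono (Fin.rev_le_rev.mpr ha) (Fin.rev_le_rev.mpr hb)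

theorem dual_lt (o : ShuffleOrder N) {b a : Fin N} :
    o.dual.lt (.unbarred b) (.barred a) ↔ o.lt (.unbarred a.rev) (.barred b.rev) := Iff.rfl

end ShuffleOrder

theorem bigBarOrder_lt (b a : Fin N) : (bigBarOrder N).lt (.unbarred b) (.barred a) := by
  have := b.isLt
  simp only [bigBarOrder, bigBarRank]
  omega

theorem natOrder_lt {b a : Fin N} : (natOrder N).lt (.unbarred b) (.barred a) ↔ b ≤ a := by
  simp only [natOrder, natRank, Fin.le_def]
  omega

@[simp] theorem dual_bigBarOrder : (bigBarOrder N).dual = bigBarOrder N :=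
  ShuffleOrder.ext_of_mixed fun _ _ => iff_of_true (bigBarOrder_lt _ _) (bigBarOrder_lt _ _)

@[simp] theorem dual_natOrder : (natOrder N).dual = natOrder N :=
  ShuffleOrder.ext_of_mixed fun b a => by
    rw [ShuffleOrder.dual_lt, natOrder_lt, natOrder_lt, Fin.rev_le_rev]

section Swaps

variable {o o' o₁ o₂ : ShuffleOrder N} {a b a' b' : Fin N}

theorem differBySwap_iff : DifferBySwap o o' b a ↔ o.lt (.unbarred b) (.barred a) ∧
    ∀ d c, o'.lt (.unbarred d) (.barred c) ↔
      o.lt (.unbarred d) (.barred c) ∧ ¬ (d = b ∧ c = a) := by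
  constructor
  · rintro ⟨h, h', hiff⟩
    refine ⟨h, fun d c => ?_⟩
    by_cases hdc : d = b ∧ c = a
    · obtain ⟨rfl, rfl⟩ := hdc
      simpa using o'.asymm h'
    · simpa [hdc] using (hiff (.unbarred d) (.barred c) (by simpa using hdc) (by simp)).symm
  · rintro ⟨h, hiff⟩
    refine ⟨h, by simp [o'.barred_lt_unbarred, hiff], ?_⟩
    rintro (x | x) (y | y) hxy hyx
    · rw [o.unbarred_lt_unbarred, o'.unbarred_lt_unbarred]
    · rw [hiff, and_iff_left (by simpa using hxy)]
    · rw [o.barred_lt_unbarred, o'.barred_lt_unbarred, hiff,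
        and_iff_left (by simpa [and_comm] using hyx)]
    · rw [o.barred_lt_barred, o'.barred_lt_barred]

theorem DifferBySwap.unbarred_lt_barred_iff (h : DifferBySwap o o' b a) {d c : Fin N} :
    o'.lt (.unbarred d) (.barred c) ↔ o.lt (.unbarred d) (.barred c) ∧ ¬ (d = b ∧ c = a) :=
  (differBySwap_iff.mp h).2 d c

theorem DifferBySwap.le_unbarred (h : DifferBySwap o o' b a) {d : Fin N}
    (hd : o.lt (.unbarred d) (.barred a)) : d ≤ b := by
  by_contra! hbd
  exact o'.asymm h.2.1 (o'.unbarred_lt_barred_mono hbd.le le_rfl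
    (h.unbarred_lt_barred_iff.mpr ⟨hd, fun hdb => hbd.ne' hdb.1⟩))

theorem DifferBySwap.barred_le (h : DifferBySwap o o' b a) {c : Fin N}
    (hc : o.lt (.unbarred b) (.barred c)) : a ≤ c := by
  by_contra! hca
  exact o'.asymm h.2.1 (o'.unbarred_lt_barred_mono le_rfl hca.le
    (h.unbarred_lt_barred_iff.mpr ⟨hc, fun hcb => hca.ne hcb.2⟩))

theorem exists_differBySwap (h : o.lt (.unbarred b) (.barred a))
    (hb : ∀ d, o.lt (.unbarred d) (.barred a) → d ≤ b)
    (ha : ∀ c, o.lt (.unbarred b) (.barred c) → a ≤ c) : ∃ o', DifferBySwap o o' b a := by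
  refine ⟨.ofTable (fun d c => o.lt (.unbarred d) (.barred c) ∧ ¬ (d = b ∧ c = a)) ?_,
    differBySwap_iff.mpr ⟨h, fun _ _ => Iff.rfl⟩⟩
  rintro d d' c c' hd hc ⟨hdc, hne⟩
  refine ⟨o.unbarred_lt_barred_mono hd hc hdc, ?_⟩
  rintro ⟨rfl, rfl⟩
  exact hne ⟨le_antisymm (hb d (o.unbarred_lt_barred_mono le_rfl hc hdc)) hd,
    le_antisymm hc (ha c (o.unbarred_lt_barred_mono hd le_rfl hdc))⟩

theorem exists_differBySwap_left (h : o'.lt (.barred a) (.unbarred b))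
    (hb : ∀ d < b, o'.lt (.unbarred d) (.barred a))
    (ha : ∀ c > a, o'.lt (.unbarred b) (.barred c)) : ∃ o, DifferBySwap o o' b a := by
  refine ⟨.ofTable (fun d c => o'.lt (.unbarred d) (.barred c) ∨ d = b ∧ c = a) ?_,
    differBySwap_iff.mpr ⟨Or.inr ⟨rfl, rfl⟩, fun d c => ?_⟩⟩
  · rintro d d' c c' hd hc (hdc | ⟨rfl, rfl⟩)
    · exact Or.inl (o'.unbarred_lt_barred_mono hd hc hdc)
    · rcases hd.lt_or_eq with hd | rfl
      · exact Or.inl (o'.unbarred_lt_barred_mono le_rfl hc (hb _ hd))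
      · exact hc.lt_or_eq.imp (ha _) fun hc => ⟨rfl, hc.symm⟩
  · change _ ↔ (_ ∨ _) ∧ _
    have : d = b ∧ c = a → ¬ o'.lt (.unbarred d) (.barred c) := by
      rintro ⟨rfl, rfl⟩
      exact o'.asymm h
    tauto

/-- The letters `b` and `ā` are on the same side of every other letter. -/
def SameSide (o : ShuffleOrder N) (b a : Fin N) : Prop :=
  ∀ z : Letter N, z ≠ .unbarred b → z ≠ .barred a →
    (o.lt z (.unbarred b) ↔ o.lt z (.barred a))

theorem DifferBySwap.sameSide_left (h : DifferBySwap o o' b a) : SameSide o b a := by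
  rintro (z | z) hb -
  · have hzb : z ≠ b := by simpa using hb
    rw [o.unbarred_lt_unbarred]
    exact ⟨fun hz => o.unbarred_lt_barred_mono hz.le le_rfl h.1,
      fun hz => lt_of_le_of_ne (h.le_unbarred hz) hzb⟩
  · rw [o.barred_lt_barred, o.barred_lt_unbarred]
    exact ⟨fun hz => lt_of_not_ge fun haz => hz (o.unbarred_lt_barred_mono le_rfl haz h.1),
      fun hz hbz => hz.not_ge (h.barred_le hbz)⟩

theorem DifferBySwap.sameSide_right (h : DifferBySwap o o' b a) : SameSide o' b a := by
  intro z hb ha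
  have := h.sameSide_left z hb ha
  rwa [h.2.2 _ _ (by simp) (by simp [ha]), h.2.2 _ _ (by simp [hb]) (by simp)] at this

theorem DifferBySwap.right_unique (h : DifferBySwap o o₁ b a) (h' : DifferBySwap o o₂ b a) :
    o₁ = o₂ :=
  ShuffleOrder.ext_of_mixed fun _ _ => by
    rw [h.unbarred_lt_barred_iff, h'.unbarred_lt_barred_iff]

theorem DifferBySwap.left_unique (h : DifferBySwap o₁ o b a) (h' : DifferBySwap o₂ o b a) :
    o₁ = o₂ :=
  ShuffleOrder.ext_of_mixed fun d c => by
    by_cases hdc : d = b ∧ c = a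
    · obtain ⟨rfl, rfl⟩ := hdc
      exact iff_of_true h.1 h'.1
    · rw [h.2.2 _ _ (by simpa using hdc) (by simp), h'.2.2 _ _ (by simpa using hdc) (by simp)]

theorem DifferBySwap.ne_and_ne (h : DifferBySwap o o₁ b a) (h' : DifferBySwap o o₂ b' a')
    (hne : ¬ (b = b' ∧ a = a')) : b ≠ b' ∧ a ≠ a' := by
  constructor
  · rintro rfl
    exact hne ⟨rfl, le_antisymm (h.barred_le h'.1) (h'.barred_le h.1)⟩
  · rintro rfl
    exact hne ⟨le_antisymm (h'.le_unbarred h.1) (h.le_unbarred h'.1), rfl⟩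

theorem DifferBySwap.diamond (h : DifferBySwap o o₁ b a) (h' : DifferBySwap o o₂ b' a')
    (hne : ¬ (b = b' ∧ a = a')) :
    ∃ o₃, DifferBySwap o₁ o₃ b' a' ∧ DifferBySwap o₂ o₃ b a := by
  obtain ⟨o₃, h₃⟩ := exists_differBySwap (o := o₁) (b := b') (a := a')
    (h.unbarred_lt_barred_iff.mpr ⟨h'.1, fun e => hne ⟨e.1.symm, e.2.symm⟩⟩)
    (fun d hd => h'.le_unbarred (h.unbarred_lt_barred_iff.mp hd).1)
    (fun c hc => h'.barred_le (h.unbarred_lt_barred_iff.mp hc).1)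
  refine ⟨o₃, h₃, differBySwap_iff.mpr ⟨h'.unbarred_lt_barred_iff.mpr ⟨h.1, hne⟩, fun d c => ?_⟩⟩
  rw [h₃.unbarred_lt_barred_iff, h.unbarred_lt_barred_iff, h'.unbarred_lt_barred_iff,
    and_right_comm]

theorem DifferBySwap.flip (h : DifferBySwap o o' b a) : DifferBySwap o'.flip o.flip a b := by
  refine ⟨h.2.1, h.1, fun x y hxy hyx => (h.2.2 x.flip y.flip ?_ ?_).symm⟩
  · cases x <;> cases y <;> simp_all
  · cases x <;> cases y <;> simp_all

theorem DifferBySwap.dual (h : DifferBySwap o o' b a) :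
    DifferBySwap o.dual o'.dual a.rev b.rev := by
  refine differBySwap_iff.mpr ⟨by simpa [ShuffleOrder.dual_lt] using h.1, fun d c => ?_⟩
  rw [ShuffleOrder.dual_lt, ShuffleOrder.dual_lt, h.unbarred_lt_barred_iff, Fin.rev_eq_iff,
    Fin.rev_eq_iff, and_comm (a := c = _)]

/-- The number of pairs `ā ⋖ b`. -/
noncomputable def inversions (o : ShuffleOrder N) : ℕ :=
  {p : Fin N × Fin N | ¬ o.lt (.unbarred p.1) (.barred p.2)}.ncard

theorem DifferBySwap.inversions_lt (h : DifferBySwap o o' b a) : inversions o < inversions o' := by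
  refine Set.ncard_lt_ncard ⟨fun p hp hp' => hp (h.unbarred_lt_barred_iff.mp hp').1, fun hs => ?_⟩
    (Set.toFinite _)
  exact hs (show (b, a) ∈ _ from o'.asymm h.2.1) h.1

/-- Every gap between consecutive unbarred letters contains at most one barred letter. -/
def SparseBarred (o : ShuffleOrder N) : Prop :=
  ∀ x z c c' : Fin N, x.val + 1 = z.val →
    o.lt (.unbarred x) (.barred c) → ¬ o.lt (.unbarred z) (.barred c) →
    o.lt (.unbarred x) (.barred c') → ¬ o.lt (.unbarred z) (.barred c') → c = c'

/-- No barred letter is strictly between `b - 1` and `b` for `o`, or strictly between `b` and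
`b + 1` for `o'`. -/
structure ClearAround (o o' : ShuffleOrder N) (b : Fin N) : Prop where
  below : ∀ x c : Fin N, x.val + 1 = b.val →
    o.lt (.unbarred x) (.barred c) → o.lt (.unbarred b) (.barred c)
  above : ∀ z c : Fin N, b.val + 1 = z.val →
    o'.lt (.unbarred b) (.barred c) → o'.lt (.unbarred z) (.barred c)

/-- A swap of `b ⋖ ā` to `ā ⋖ b` with no other barred letter next to `b`. -/
def ClearSwap (o o' : ShuffleOrder N) : Prop :=
  ∃ b a, DifferBySwap o o' b a ∧ ClearAround o o' b

theorem ClearSwap.differBySwap (h : ClearSwap o o') : ∃ b a, DifferBySwap o o' b a := by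
  obtain ⟨b, a, hba, -⟩ := h
  exact ⟨b, a, hba⟩

theorem ClearSwap.differBySwap_of_flip (h : ClearSwap o'.flip o.flip) :
    ∃ b a, DifferBySwap o o' b a := by
  obtain ⟨b, a, hba, -⟩ := h
  exact ⟨a, b, by simpa using hba.flip⟩

theorem ClearSwap.flip_dual (h : ClearSwap o o') : ClearSwap o'.dual.flip o.dual.flip := by
  obtain ⟨b, a, hba, hclear⟩ := h
  have flip_dual_lt (p : ShuffleOrder N) (d c : Fin N) : p.dual.flip.lt (.unbarred d) (.barred c) ↔
      ¬ p.lt (.unbarred d.rev) (.barred c.rev) := by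
    rw [ShuffleOrder.flip_lt]
    exact p.dual.barred_lt_unbarred
  refine ⟨_, _, hba.dual.flip, fun x c hx => ?_, fun z c hz => ?_⟩
  · rw [flip_dual_lt, flip_dual_lt, not_imp_not, Fin.rev_rev]
    exact hclear.above _ _ (by rw [Fin.val_rev] at hx ⊢; omega)
  · rw [flip_dual_lt, flip_dual_lt, not_imp_not, Fin.rev_rev]
    exact hclear.below _ _ (by rw [Fin.val_rev] at hz ⊢; omega)

theorem sparseBarred_natOrder : SparseBarred (natOrder N) := by
  intro x z c c' h
  simp only [natOrder_lt, Fin.le_def, Fin.ext_iff]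
  omega

theorem sparseBarred_bigBarOrder : SparseBarred (bigBarOrder N) :=
  fun _ z c _ _ _ hz => absurd (bigBarOrder_lt z c) hz

theorem sparseBarred_flip_natOrder : SparseBarred (natOrder N).flip := by
  intro x z c c' h
  simp only [ShuffleOrder.flip_lt, Letter.flip, natOrder, natRank, Fin.ext_iff]
  omega

theorem sparseBarred_flip_bigBarOrder : SparseBarred (bigBarOrder N).flip :=
  fun x _ c _ _ hx => absurd hx ((bigBarOrder N).asymm (bigBarOrder_lt c x))

theorem exists_extremal_swap (hne : o' ≠ bigBarOrder N) :
    ∃ o b a, DifferBySwap o o' b a ∧ (∀ d < b, o'.lt (.unbarred d) (.barred a)) ∧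
      ∀ c > a, ∀ d, o'.lt (.unbarred d) (.barred c) := by
  have hinv : {c | ∃ d, ¬ o'.lt (.unbarred d) (.barred c)}.Nonempty := by
    by_contra! hn
    refine hne (ShuffleOrder.ext_of_mixed fun d c => iff_of_true ?_ (bigBarOrder_lt d c))
    by_contra hdc
    exact Set.eq_empty_iff_forall_notMem.mp hn c ⟨d, hdc⟩
  obtain ⟨a, ha, hmax⟩ := Set.exists_max_image _ id (Set.toFinite _) hinv
  obtain ⟨b, hb, hmin⟩ :=
    Set.exists_min_image {d | ¬ o'.lt (.unbarred d) (.barred a)} id (Set.toFinite _) ha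
  have above : ∀ c > a, ∀ d, o'.lt (.unbarred d) (.barred c) := fun c hc d => by
    by_contra hdc
    exact (hmax c ⟨d, hdc⟩).not_gt hc
  have below : ∀ d < b, o'.lt (.unbarred d) (.barred a) := fun d hd => by
    by_contra hda
    exact (hmin d hda).not_gt hd
  obtain ⟨o, ho⟩ := exists_differBySwap_left (o'.barred_lt_unbarred.mpr hb) below
    fun c hc => above c hc b
  exact ⟨o, b, a, ho, below, above⟩

theorem exists_clearSwap (hne : o' ≠ bigBarOrder N) (hs : SparseBarred o') :
    ∃ o, ClearSwap o o' ∧ SparseBarred o ∧ inversions o < inversions o' := by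
  obtain ⟨o, b, a, ho, hmin, hmax⟩ := exists_extremal_swap hne
  have hb : ¬ o'.lt (.unbarred b) (.barred a) := o'.asymm ho.2.1
  have hclear : ClearAround o o' b := by
    refine ⟨fun x c hx hxc => ?_, fun z c _ hbc => ?_⟩
    · by_contra hbc
      have hxb : x < b := Fin.lt_def.mpr (by omega)
      have hca : c = a := hs x b c a hx (ho.unbarred_lt_barred_iff.mpr ⟨hxc, fun h => hxb.ne h.1⟩)
        (fun h => hbc (ho.unbarred_lt_barred_iff.mp h).1) (hmin x hxb) hb
      exact hbc (hca ▸ ho.1)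
    · exact hmax c (lt_of_not_ge fun hca => hb (o'.unbarred_lt_barred_mono le_rfl hca hbc)) z
  refine ⟨o, ⟨b, a, ho, hclear⟩, fun x z c c' hxz hx hz hx' hz' => ?_, ho.inversions_lt⟩
  rcases eq_or_ne x b with rfl | hxb
  · have eq_a : ∀ d, o.lt (.unbarred x) (.barred d) → ¬ o.lt (.unbarred z) (.barred d) → d = a := by
      intro d hd hzd
      by_contra hda
      exact hzd (ho.unbarred_lt_barred_iff.mp
        (hclear.above z d hxz (ho.unbarred_lt_barred_iff.mpr ⟨hd, fun h => hda h.2⟩))).1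
    rw [eq_a c hx hz, eq_a c' hx' hz']
  · exact hs x z c c' hxz (ho.unbarred_lt_barred_iff.mpr ⟨hx, fun h => hxb h.1⟩)
      (fun h => hz (ho.unbarred_lt_barred_iff.mp h).1)
      (ho.unbarred_lt_barred_iff.mpr ⟨hx', fun h => hxb h.1⟩)
      (fun h => hz' (ho.unbarred_lt_barred_iff.mp h).1)

theorem reflTransGen_bigBarOrder {r : ShuffleOrder N → ShuffleOrder N → Prop}
    {p : ShuffleOrder N → Prop} (hr : ∀ o', o' ≠ bigBarOrder N → p o' →
      ∃ o, r o o' ∧ p o ∧ inversions o < inversions o') (ho : p o) :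
    ReflTransGen r (bigBarOrder N) o := by
  induction o using (measure inversions).wf.induction with
  | _ o' ih =>
    by_cases hne : o' = bigBarOrder N
    · rw [hne]
    · obtain ⟨o, hoo', hpo, hlt⟩ := hr o' hne ho
      exact (ih o hlt hpo).tail hoo'

theorem reflTransGen_differBySwap (o : ShuffleOrder N) :
    ReflTransGen (fun o o' : ShuffleOrder N => ∃ b a, DifferBySwap o o' b a)
      (bigBarOrder N) o := by
  refine reflTransGen_bigBarOrder (p := fun _ => True) (fun o' hne _ => ?_) trivial
  obtain ⟨o, b, a, ho, -⟩ := exists_extremal_swap hne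
  exact ⟨o, ⟨b, a, ho⟩, trivial, ho.inversions_lt⟩

theorem reflTransGen_clearSwap : ReflTransGen ClearSwap (bigBarOrder N) (natOrder N) :=
  reflTransGen_bigBarOrder (fun _ => exists_clearSwap) sparseBarred_natOrder

theorem reflTransGen_clearSwap_flip :
    ReflTransGen (fun o o' : ShuffleOrder N => ClearSwap o'.flip o.flip)
      (bigBarOrder N) (natOrder N) := by
  have h := ReflTransGen.lift (p := fun o o' : ShuffleOrder N => ClearSwap o'.flip o.flip)
    ShuffleOrder.dual (fun _ _ => ClearSwap.flip_dual) _ _ (reflTransGen_clearSwap (N := N))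
  rwa [Function.onFun, dual_bigBarOrder, dual_natOrder] at h

end Swaps

end ShuffleOrders

section Permutations

variable {X : Type*}

theorem ncard_comp_perm {α : Type*} {τ : Equiv.Perm X} {s : Set X} (hτ : ∀ x, τ x ∈ s ↔ x ∈ s)
    (f : X → α) (y : α) : {x ∈ s | (f ∘ τ) x = y}.ncard = {x ∈ s | f x = y}.ncard := by
  rw [← Set.ncard_image_of_injective _ τ.injective]
  congr 1
  ext x
  rw [← τ.apply_symm_apply x, τ.injective.mem_set_image]
  exact and_congr_left fun _ => (hτ _).symm

variable [Finite X] {S : X → X → Prop}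

theorem exists_perm_of_biUnique (hS : Relator.BiUnique S) :
    ∃ τ : Equiv.Perm X, ∀ x y, S x y → τ y = x := by
  classical
  have := Fintype.ofFinite X
  let f : X → X := fun y => if h : ∃ x, S x y then h.choose else y
  have hf : ∀ {x y}, S x y → f y = x := fun {x y} h => by
    have hex : ∃ x, S x y := ⟨x, h⟩
    simp only [f, dif_pos hex]
    exact hS.1 hex.choose_spec h
  have hinj : Set.InjOn f {y | ∃ x, S x y} := by
    rintro y ⟨x, hx⟩ z ⟨w, hw⟩ hyz
    rw [hf hx, hf hw] at hyz
    exact hS.2 (hyz ▸ hx) hw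
  obtain ⟨τ, hτ⟩ := Set.MapsTo.exists_equiv_extend_of_card_eq (t := Finset.univ)
    Finset.card_univ.symm (fun _ _ => by simp) hinj
  refine ⟨τ.trans (Equiv.subtypeUnivEquiv Finset.mem_univ), fun x y h => ?_⟩
  exact (hτ y ⟨x, h⟩).trans (hf h)

theorem exists_perm_of_biUnique_of_le (hS : Relator.BiUnique S) (s : Setoid X)
    (hs : ∀ x y, S x y → s x y) :
    ∃ τ : Equiv.Perm X, (∀ x y, S x y → τ y = x) ∧ ∀ x, s (τ x) x := by
  have hex : ∀ q : Quotient s, ∃ τ : Equiv.Perm {x // Quotient.mk s x = q},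
      ∀ x y, S x.1 y.1 → τ y = x := fun q =>
    exists_perm_of_biUnique (S := fun x y => S x.1 y.1)
      ⟨fun _ _ _ h h' => Subtype.ext (hS.1 h h'), fun _ _ _ h h' => Subtype.ext (hS.2 h h')⟩
  choose τ hτ using hex
  refine ⟨Equiv.ofFiberEquiv τ, fun x y h => ?_, fun x => ?_⟩
  · have hxy : Quotient.mk s x = Quotient.mk s y := Quotient.sound (hs x y h)
    exact congrArg Subtype.val (hτ _ ⟨x, hxy⟩ ⟨y, rfl⟩ h)
  · exact Quotient.exact (Equiv.ofFiberEquiv_map τ x)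

end Permutations

section Tableaux

variable {N : ℕ} {ν : YoungDiagram} {o o' : ShuffleOrder N} {b a : Fin N} {T T' : Filling N ν}

instance : Finite ν :=
  Finite.of_injective (β := ν.cells) (fun c => ⟨c.1, c.2⟩) fun _ _ h =>
    Subtype.ext (congrArg (fun x : ν.cells => x.1) h)

section Components

variable {R : Set ν} {c d : ν}

theorem component_equivalence (R : Set ν) : Equivalence fun c d : ν => d ∈ component R c where
  refl _ := .refl
  symm h := ReflTransGen.mono
    (fun _ _ h => ⟨h.2.1, h.1, by have := h.2.2; unfold BoxAdj at *; omega⟩) _ _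
    (reflTransGen_swap.mpr h)
  trans h h' := ReflTransGen.trans h h'

theorem component_subset (hc : c ∈ R) : component R c ⊆ R := fun d h => by
  rcases ReflTransGen.cases_tail h with rfl | ⟨_, _, h⟩
  exacts [hc, h.2.1]

theorem component_of_notMem (hc : c ∉ R) : component R c = {c} := by
  ext d
  refine ⟨fun h => ?_, fun h => h ▸ (component_equivalence R).refl c⟩
  rcases ReflTransGen.cases_head h with rfl | ⟨_, h, _⟩
  exacts [rfl, absurd h.1 hc]

/-- `d` is the right or the upper neighbour of `c`, both in `R`. -/
def Next (R : Set ν) (c d : ν) : Prop :=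
  c ∈ R ∧ d ∈ R ∧
    ((c.1.1 = d.1.1 ∧ c.1.2 + 1 = d.1.2) ∨ (c.1.2 = d.1.2 ∧ d.1.1 + 1 = c.1.1))

theorem boxAdj_iff_next : (c ∈ R ∧ d ∈ R ∧ BoxAdj c.1 d.1) ↔ Next R c d ∨ Next R d c := by
  unfold Next BoxAdj
  constructor
  · rintro ⟨h1, h2, h3⟩
    simp only [h1, h2, true_and]
    omega
  · rintro (⟨h1, h2, h3⟩ | ⟨h1, h2, h3⟩) <;> refine ⟨by assumption, by assumption, ?_⟩ <;> omega

theorem Next.mem_component (h : Next R c d) : d ∈ component R c :=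
  ReflTransGen.single (boxAdj_iff_next.mpr (.inl h))

theorem chain_of_mem_component (hR : Relator.BiUnique (Next R)) (h : d ∈ component R c) :
    ReflTransGen (Next R) c d ∨ ReflTransGen (Next R) d c := by
  induction h with
  | refl => exact .inl .refl
  | tail _ hxy ih =>
    rcases boxAdj_iff_next.mp hxy with hxy | hxy <;> rcases ih with ih | ih
    · exact .inl (ih.tail hxy)
    · rcases ih.cases_head with rfl | ⟨z, hz, hzc⟩
      exacts [.inl (.single hxy), .inr (hR.2 hz hxy ▸ hzc)]
    · rcases ih.cases_tail with rfl | ⟨z, hcz, hz⟩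
      exacts [.inr (.single hxy), .inl (hR.1 hz hxy ▸ hcz)]
    · exact .inr (.head hxy ih)

end Components

section Refillings

/-- The two letters exchanged by a swap. -/
def swapPair (b a : Fin N) : Set (Letter N) := {.unbarred b, .barred a}

theorem mem_ribbon {c : ν} : c ∈ ribbon T b a ↔ T c ∈ swapPair b a := Iff.rfl

theorem refills_comp {τ : Equiv.Perm ν} (hτ : ∀ d, τ d ∈ component (ribbon T b a) d) :
    Refills b a T (T ∘ τ) := by
  refine ⟨fun c hc => ?_, fun c _ => ?_⟩
  · have hc' := hτ c
    rw [component_of_notMem hc] at hc'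
    exact congrArg T hc'
  · have hmem : ∀ d, τ d ∈ component (ribbon T b a) c ↔ d ∈ component (ribbon T b a) c := fun d =>
      ⟨fun h => ReflTransGen.trans h ((component_equivalence _).symm (hτ d)),
        fun h => ReflTransGen.trans h (hτ d)⟩
    exact ⟨ncard_comp_perm hmem _ _, ncard_comp_perm hmem _ _⟩

theorem ncard_swapPair (T : Filling N ν) (K : Set ν) :
    {d ∈ K | T d ∈ swapPair b a}.ncard =
      {d ∈ K | T d = .unbarred b}.ncard + {d ∈ K | T d = .barred a}.ncard := by
  rw [← Set.ncard_union_eq _ (Set.toFinite _) (Set.toFinite _)]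
  · congr 1
    ext d
    exact and_or_left
  · rw [Set.disjoint_left]
    rintro d ⟨_, h⟩ ⟨_, h'⟩
    simp [h] at h'

namespace Refills

theorem mem_swapPair (h : Refills b a T T') {c : ν} (hc : c ∈ ribbon T b a) :
    T' c ∈ swapPair b a := by
  set K := component (ribbon T b a) c
  have hK : {d ∈ K | T d ∈ swapPair b a} = K :=
    Set.sep_eq_self_iff_mem_true.mpr fun d hd => component_subset hc hd
  have hK' : {d ∈ K | T' d ∈ swapPair b a} = K := by
    refine Set.eq_of_subset_of_ncard_le (Set.sep_subset _ _) ?_ (Set.toFinite _)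
    rw [ncard_swapPair, (h.2 c hc).1, (h.2 c hc).2, ← ncard_swapPair, hK]
  exact (hK'.ge ((component_equivalence _).refl c)).2

theorem ribbon_eq (h : Refills b a T T') : ribbon T' b a = ribbon T b a := by
  ext c
  refine ⟨fun hc => ?_, h.mem_swapPair⟩
  by_contra hn
  rw [mem_ribbon, h.1 c hn] at hc
  exact hn hc

theorem eq_or_mem_swapPair (h : Refills b a T T') (c : ν) :
    T' c = T c ∨ T c ∈ swapPair b a ∧ T' c ∈ swapPair b a := by
  by_cases hc : c ∈ ribbon T b a
  exacts [.inr ⟨hc, h.mem_swapPair hc⟩, .inl (h.1 c hc)]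

theorem symm (h : Refills b a T T') : Refills b a T' T := by
  simp only [Refills, h.ribbon_eq]
  exact ⟨fun c hc => (h.1 c hc).symm, fun c hc => ⟨(h.2 c hc).1.symm, (h.2 c hc).2.symm⟩⟩

end Refills

end Refillings

section Colored

/-- The condition on the entries `x` and `y` of two boxes of a colored tableau, the box of `x` being
before that of `y` in the same row (`β = true`) or column (`β = false`): the letters that are
barred, respectively unbarred, have to increase strictly. -/
def ShuffleOrder.Precedes (o : ShuffleOrder N) (β : Bool) (x y : Letter N) : Prop :=
  o.lt x y ∨ x = y ∧ x.isBarred ≠ β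

theorem isColored_iff : IsColored o T ↔
    (∀ c d : ν, c.1.1 = d.1.1 → c.1.2 < d.1.2 → o.Precedes true (T c) (T d)) ∧
      ∀ c d : ν, c.1.2 = d.1.2 → c.1.1 < d.1.1 → o.Precedes false (T c) (T d) := by
  have key (β : Bool) (x y : Letter N) :
      o.Precedes β x y ↔ (x = y ∨ o.lt x y) ∧ (x.isBarred = β → x ≠ y) := by
    have := o.irrefl x
    unfold ShuffleOrder.Precedes
    grind
  simp only [key]
  exact ⟨fun h => ⟨fun c d h₁ h₂ => ⟨h.row_weak c d h₁ h₂, h.row_strict c d h₁ h₂⟩,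
    fun c d h₁ h₂ => ⟨h.col_weak c d h₁ h₂, h.col_strict c d h₁ h₂⟩⟩,
    fun h => ⟨fun c d h₁ h₂ => (h.1 c d h₁ h₂).1, fun c d h₁ h₂ => (h.2 c d h₁ h₂).1,
      fun c d h₁ h₂ => (h.1 c d h₁ h₂).2, fun c d h₁ h₂ => (h.2 c d h₁ h₂).2⟩⟩

namespace IsColored

theorem row (hT : IsColored o T) {c d : ν} (h₁ : c.1.1 = d.1.1) (h₂ : c.1.2 < d.1.2) :
    o.Precedes true (T c) (T d) := (isColored_iff.mp hT).1 c d h₁ h₂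

theorem col (hT : IsColored o T) {c d : ν} (h₁ : c.1.2 = d.1.2) (h₂ : c.1.1 < d.1.1) :
    o.Precedes false (T c) (T d) := (isColored_iff.mp hT).2 c d h₁ h₂

end IsColored

theorem ShuffleOrder.Precedes.rank_le {β : Bool} {x y : Letter N} (h : o.Precedes β x y) :
    o.rank x ≤ o.rank y := by
  rcases h with h | ⟨rfl, -⟩
  exacts [(o.rank_lt_rank h).le, le_rfl]

theorem IsColored.rank_mono (hT : IsColored o T) {c d : ν} (h : c.1 ≤ d.1) :
    o.rank (T c) ≤ o.rank (T d) := by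
  let m : ν := ⟨(c.1.1, d.1.2), ν.up_left_mem h.1 le_rfl d.2⟩
  have hcm : o.rank (T c) ≤ o.rank (T m) := by
    rcases h.2.lt_or_eq with h₂ | h₂
    exacts [(hT.row (c := c) (d := m) rfl h₂).rank_le, (congrArg (fun x => o.rank (T x))
      (Subtype.ext (Prod.ext rfl h₂) : c = m)).le]
  have hmd : o.rank (T m) ≤ o.rank (T d) := by
    rcases h.1.lt_or_eq with h₁ | h₁
    exacts [(hT.col (c := m) (d := d) rfl h₁).rank_le, (congrArg (fun x => o.rank (T x))
      (Subtype.ext (Prod.ext h₁ rfl) : m = d)).le]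
  exact hcm.trans hmd

theorem SameSide.lt_iff_left (hs : SameSide o b a) {x x' z : Letter N} (hz : z ∉ swapPair b a)
    (hx : x ∈ swapPair b a) (hx' : x' ∈ swapPair b a) : o.lt z x ↔ o.lt z x' := by
  have hz' := hs z (fun h => hz (.inl h)) (fun h => hz (.inr h))
  rcases hx with rfl | rfl <;> rcases hx' with rfl | rfl
  exacts [Iff.rfl, hz', hz'.symm, Iff.rfl]

theorem SameSide.lt_iff_right (hs : SameSide o b a) {x x' z : Letter N} (hz : z ∉ swapPair b a)
    (hx : x ∈ swapPair b a) (hx' : x' ∈ swapPair b a) : o.lt x z ↔ o.lt x' z := by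
  have key : ∀ y ∈ swapPair b a, (o.lt y z ↔ ¬ o.lt z y) := fun y hy =>
    ⟨o.asymm, (o.lt_or_gt fun h : y = z => hz (h ▸ hy)).resolve_right⟩
  rw [key x hx, key x' hx', hs.lt_iff_left hz hx hx']

theorem mem_ribbon_of_between (hT : IsColored o T) (hs : SameSide o b a) {c m d : ν}
    (hc : c ∈ ribbon T b a) (hd : d ∈ ribbon T b a) (hcm : c.1 ≤ m.1) (hmd : m.1 ≤ d.1) :
    m ∈ ribbon T b a := by
  by_contra hm
  have hne : ∀ d ∈ ribbon T b a, T d ≠ T m := fun d hd h => hm (mem_ribbon.mpr (h ▸ hd))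
  have hlt : o.lt (T c) (T m) := by
    refine (o.lt_or_gt (hne c hc)).resolve_right fun h => ?_
    exact (o.rank_lt_rank h).not_ge (hT.rank_mono hcm)
  have hlt' : o.lt (T m) (T d) := by
    refine (o.lt_or_gt (hne d hd).symm).resolve_right fun h => ?_
    exact (o.rank_lt_rank h).not_ge (hT.rank_mono hmd)
  exact o.asymm hlt' ((hs.lt_iff_right hm hc hd).mp hlt)

namespace IsColored

variable {c d : ν}

theorem row_left (hT : IsColored o T) (hlt : o.lt (.unbarred b) (.barred a))
    (hc : c ∈ ribbon T b a) (hd : d ∈ ribbon T b a) (h₁ : c.1.1 = d.1.1) (h₂ : c.1.2 < d.1.2) :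
    T c = .unbarred b := by
  refine hc.resolve_right fun hca => ?_
  rcases hT.row h₁ h₂ with h | ⟨-, h⟩
  · rcases hd with hd | hd <;> rw [hca, hd] at h
    exacts [o.asymm hlt h, o.irrefl _ h]
  · exact h (by rw [hca]; rfl)

theorem col_lower (hT : IsColored o T) (hlt : o.lt (.unbarred b) (.barred a))
    (hc : c ∈ ribbon T b a) (hd : d ∈ ribbon T b a) (h₁ : c.1.2 = d.1.2) (h₂ : c.1.1 < d.1.1) :
    T d = .barred a := by
  refine hd.resolve_left fun hdb => ?_
  rcases hT.col h₁ h₂ with h | ⟨h, h'⟩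
  · rcases hc with hc | hc <;> rw [hc, hdb] at h
    exacts [o.irrefl _ h, o.asymm hlt h]
  · exact h' (by rw [h, hdb]; rfl)

theorem row_right (hT : IsColored o T) (hlt : o.lt (.barred a) (.unbarred b))
    (hc : c ∈ ribbon T b a) (hd : d ∈ ribbon T b a) (h₁ : c.1.1 = d.1.1) (h₂ : c.1.2 < d.1.2) :
    T d = .unbarred b := by
  refine hd.resolve_right fun hda => ?_
  rcases hT.row h₁ h₂ with h | ⟨h, h'⟩
  · rcases hc with hc | hc <;> rw [hc, hda] at h
    exacts [o.asymm hlt h, o.irrefl _ h]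
  · exact h' (by rw [h, hda]; rfl)

theorem col_upper (hT : IsColored o T) (hlt : o.lt (.barred a) (.unbarred b))
    (hc : c ∈ ribbon T b a) (hd : d ∈ ribbon T b a) (h₁ : c.1.2 = d.1.2) (h₂ : c.1.1 < d.1.1) :
    T c = .barred a := by
  refine hc.resolve_left fun hcb => ?_
  rcases hT.col h₁ h₂ with h | ⟨-, h⟩
  · rcases hd with hd | hd <;> rw [hcb, hd] at h
    exacts [o.irrefl _ h, o.asymm hlt h]
  · exact h (by rw [hcb]; rfl)

theorem not_square (hT : IsColored o T) {p q r s : ν} (hp : p ∈ ribbon T b a)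
    (hq : q ∈ ribbon T b a) (hr : r ∈ ribbon T b a) (hs : s ∈ ribbon T b a)
    (hpq : p.1.1 = q.1.1 ∧ p.1.2 < q.1.2) (hrs : r.1.1 = s.1.1 ∧ r.1.2 < s.1.2)
    (hpr : p.1.2 = r.1.2 ∧ p.1.1 < r.1.1) (hqs : q.1.2 = s.1.2 ∧ q.1.1 < s.1.1) : False := by
  have hne : (.unbarred b : Letter N) ≠ .barred a := by simp
  rcases o.lt_or_gt hne with hlt | hlt
  · exact hne ((hT.row_left hlt hr hs hrs.1 hrs.2).symm.trans
      (hT.col_lower hlt hp hr hpr.1 hpr.2))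
  · exact hne ((hT.row_right hlt hp hq hpq.1 hpq.2).symm.trans
      (hT.col_upper hlt hq hs hqs.1 hqs.2))

end IsColored

theorem next_right_unique (hT : IsColored o T) (hs : SameSide o b a) :
    Relator.RightUnique (Next (ribbon T b a)) := by
  have not_both : ∀ c d d' : ν, Next (ribbon T b a) c d → Next (ribbon T b a) c d' →
      c.1.1 = d.1.1 → c.1.2 + 1 = d.1.2 → c.1.2 = d'.1.2 → d'.1.1 + 1 = c.1.1 → False := by
    intro c d d' h h' _ _ _ _
    have hrow : d'.1.1 ≤ d.1.1 := by omega
    have hcol : d'.1.2 ≤ d.1.2 := by omega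
    let q : ν := ⟨(d'.1.1, d.1.2), ν.up_left_mem hrow le_rfl d.2⟩
    have hq : q ∈ ribbon T b a :=
      mem_ribbon_of_between hT hs h'.2.1 h.2.1 ⟨le_rfl, hcol⟩ ⟨hrow, le_rfl⟩
    exact hT.not_square h'.2.1 hq h.1 h.2.1 ⟨rfl, by simp only [q]; omega⟩ (by omega) (by omega)
      ⟨rfl, by simp only [q]; omega⟩
  intro c d d' h h'
  rcases h.2.2 with ⟨e₁, e₂⟩ | ⟨e₁, e₂⟩ <;> rcases h'.2.2 with ⟨e₃, e₄⟩ | ⟨e₃, e₄⟩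
  · exact Subtype.ext (Prod.ext (by omega) (by omega))
  · exact (not_both c d d' h h' e₁ e₂ e₃ e₄).elim
  · exact (not_both c d' d h' h e₃ e₄ e₁ e₂).elim
  · exact Subtype.ext (Prod.ext (by omega) (by omega))

end Colored

section Transposition

/-- Transposition, as a bijection between the boxes of `νᵗ` and of `ν`. -/
def transposeBox (ν : YoungDiagram) : ν.transpose ≃ ν where
  toFun c := ⟨c.1.swap, YoungDiagram.mem_transpose.mp c.2⟩
  invFun c := ⟨c.1.swap, YoungDiagram.mem_transpose.mpr (by rw [Prod.swap_swap]; exact c.2)⟩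

/-- Transposing a filling while exchanging barred and unbarred letters. This turns colored tableaux
for `o` into colored tableaux for `o.flip`. -/
def transposeFilling : Filling N ν ≃ Filling N ν.transpose :=
  (transposeBox ν).symm.arrowCongr Letter.flip_involutive.toPerm

theorem transposeFilling_apply (c : ν.transpose) :
    transposeFilling T c = (T (transposeBox ν c)).flip := rfl

theorem isColored_transposeFilling : IsColored o.flip (transposeFilling T) ↔ IsColored o T := by
  have precedes_flip (β : Bool) (x y : Letter N) :
      o.flip.Precedes β x.flip y.flip ↔ o.Precedes (!β) x y := by
    simp only [ShuffleOrder.Precedes, ShuffleOrder.flip_lt, Letter.flip_flip,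
      Letter.flip_involutive.injective.eq_iff, Letter.isBarred_flip, ne_eq, Bool.not_eq_eq_eq_not]
  rw [isColored_iff, isColored_iff, and_comm]
  refine and_congr ?_ ?_ <;>
    exact (transposeBox ν).forall_congr fun c => (transposeBox ν).forall_congr fun d =>
      imp_congr_right fun _ => imp_congr_right fun _ => precedes_flip _ _ _

theorem ribbon_transposeFilling :
    ribbon (transposeFilling T) a b = transposeBox ν ⁻¹' ribbon T b a := by
  ext c
  simp only [ribbon, Set.mem_preimage, Set.mem_ofPred_eq, transposeFilling_apply,
    Letter.flip_involutive.eq_iff, Letter.flip_unbarred, Letter.flip_barred]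
  exact or_comm

theorem component_preimage_transposeBox (R : Set ν) (c : ν.transpose) :
    component (transposeBox ν ⁻¹' R) c = transposeBox ν ⁻¹' component R (transposeBox ν c) := by
  ext d
  constructor
  · exact fun h => ReflTransGen.lift (transposeBox ν) (fun _ _ h => ⟨h.1, h.2.1, h.2.2.symm⟩) _ _ h
  · intro h
    have := ReflTransGen.lift (p := fun d d' : ν.transpose => d ∈ transposeBox ν ⁻¹' R ∧
      d' ∈ transposeBox ν ⁻¹' R ∧ BoxAdj d.1 d'.1) (transposeBox ν).symm
      (fun _ _ h => ⟨h.1, h.2.1, h.2.2.symm⟩) _ _ h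
    rwa [Function.onFun, Equiv.symm_apply_apply, Equiv.symm_apply_apply] at this

theorem refills_transposeFilling :
    Refills a b (transposeFilling T) (transposeFilling T') ↔ Refills b a T T' := by
  have ncard_transpose (F : Filling N ν) (x : Letter N) (c : ν.transpose) :
      {d ∈ component (ribbon (transposeFilling T) a b) c | transposeFilling F d = x}.ncard =
        {d ∈ component (ribbon T b a) (transposeBox ν c) | F d = x.flip}.ncard := by
    rw [← Set.ncard_preimage_of_injective_subset_range (transposeBox ν).injective (by simp),
      ribbon_transposeFilling, component_preimage_transposeBox]
    congr 1
    ext d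
    exact and_congr_right fun _ => Letter.flip_involutive.eq_iff
  unfold Refills
  refine and_congr ?_ ?_
  · refine (transposeBox ν).forall_congr fun c => imp_congr ?_ ?_
    · rw [ribbon_transposeFilling, Set.mem_preimage]
    · exact Letter.flip_involutive.injective.eq_iff
  · refine (transposeBox ν).forall_congr fun c => imp_congr ?_ ?_
    · rw [ribbon_transposeFilling, Set.mem_preimage]
    · simp only [ncard_transpose, Letter.flip_unbarred, Letter.flip_barred]
      exact and_comm

theorem next_preimage_transposeBox {R : Set ν} {c d : ν} :
    Next (transposeBox ν ⁻¹' R) ((transposeBox ν).symm d) ((transposeBox ν).symm c) ↔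
      Next R c d := by
  unfold Next
  simp only [Set.mem_preimage, Equiv.apply_symm_apply]
  simp only [transposeBox, Equiv.coe_fn_symm_mk, Prod.fst_swap, Prod.snd_swap]
  grind

theorem SameSide.flip (hs : SameSide o b a) : SameSide o.flip a b := fun z ha hb =>
  (hs z.flip (fun h => hb (by rw [← z.flip_flip, h]; rfl))
    (fun h => ha (by rw [← z.flip_flip, h]; rfl))).symm

end Transposition

theorem next_biUnique (hT : IsColored o T) (hs : SameSide o b a) :
    Relator.BiUnique (Next (ribbon T b a)) := by
  refine ⟨fun c d e h h' => (transposeBox ν).symm.injective ?_, next_right_unique hT hs⟩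
  have hunique := next_right_unique (isColored_transposeFilling.mpr hT) hs.flip
  rw [ribbon_transposeFilling] at hunique
  exact hunique (next_preimage_transposeBox.mpr h) (next_preimage_transposeBox.mpr h')

theorem DifferBySwap.precedes (h : DifferBySwap o o' b a) {β : Bool} {x x' y y' : Letter N}
    (hx : x' = x ∨ x ∈ swapPair b a ∧ x' ∈ swapPair b a)
    (hy : y' = y ∨ y ∈ swapPair b a ∧ y' ∈ swapPair b a)
    (hxy : ¬ (x ∈ swapPair b a ∧ y ∈ swapPair b a)) (hprec : o.Precedes β x y) :
    o'.Precedes β x' y' := by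
  have hlt : o.lt x y ↔ o'.lt x y :=
    h.2.2 x y (fun e => hxy ⟨.inl e.1, .inr e.2⟩) (fun e => hxy ⟨.inr e.1, .inl e.2⟩)
  by_cases hx' : x ∈ swapPair b a
  · have hy' : y ∉ swapPair b a := fun hy' => hxy ⟨hx', hy'⟩
    obtain rfl := hy.resolve_right fun e => hy' e.1
    have hne : x ≠ y' := fun e => hy' (e ▸ hx')
    have hx'' : x' ∈ swapPair b a := hx.elim (fun e => e ▸ hx') (·.2)
    have := hlt.mp (hprec.resolve_right fun e => hne e.1)
    exact .inl ((h.sameSide_right.lt_iff_right hy' hx' hx'').mp this)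
  · obtain rfl := hx.resolve_right fun e => hx' e.1
    rcases hy with rfl | ⟨hy, hy'⟩
    · exact hprec.imp hlt.mp id
    · have hne : x' ≠ y := fun e => hx' (e ▸ hy)
      have := hlt.mp (hprec.resolve_right fun e => hne e.1)
      exact .inl ((h.sameSide_right.lt_iff_left hx' hy hy').mp this)

theorem Refills.isColored (hR : Refills b a T T') (h : DifferBySwap o o' b a)
    (hT : IsColored o T)
    (hrow : ∀ c ∈ ribbon T b a, ∀ d ∈ ribbon T b a, c.1.1 = d.1.1 → c.1.2 < d.1.2 →
      T' d = .unbarred b)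
    (hcol : ∀ c ∈ ribbon T b a, ∀ d ∈ ribbon T b a, c.1.2 = d.1.2 → c.1.1 < d.1.1 →
      T' c = .barred a) : IsColored o' T' := by
  refine isColored_iff.mpr ⟨fun c d h₁ h₂ => ?_, fun c d h₁ h₂ => ?_⟩ <;>
    by_cases hcd : c ∈ ribbon T b a ∧ d ∈ ribbon T b a
  · rw [hrow c hcd.1 d hcd.2 h₁ h₂]
    rcases hR.mem_swapPair hcd.1 with hc | hc <;> rw [hc]
    exacts [.inr ⟨rfl, Bool.false_ne_true⟩, .inl h.2.1]
  · exact h.precedes (hR.eq_or_mem_swapPair c) (hR.eq_or_mem_swapPair d) hcd (hT.row h₁ h₂)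
  · rw [hcol c hcd.1 d hcd.2 h₁ h₂]
    rcases hR.mem_swapPair hcd.2 with hd | hd <;> rw [hd]
    exacts [.inl h.2.1, .inr ⟨rfl, Bool.true_eq_false.mp⟩]
  · exact h.precedes (hR.eq_or_mem_swapPair c) (hR.eq_or_mem_swapPair d) hcd (hT.col h₁ h₂)

/-
In each component of the ribbon, which is a path from southwest to northeast, shift the letters
one step to the northeast, and move the last one to the southwestern end.
-/
theorem exists_refill (h : DifferBySwap o o' b a) (hT : IsColored o T) :
    ∃ τ : Equiv.Perm ν, (∀ d, τ d ∈ component (ribbon T b a) d) ∧ IsColored o' (T ∘ τ) := by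
  have hs := h.sameSide_left
  obtain ⟨τ, hτ, hmem⟩ := exists_perm_of_biUnique_of_le (next_biUnique hT hs)
    ⟨_, component_equivalence (ribbon T b a)⟩ fun _ _ => Next.mem_component
  have hτR : ∀ d, τ d ∈ component (ribbon T b a) d :=
    fun d => (component_equivalence _).symm (hmem d)
  refine ⟨τ, hτR, (refills_comp hτR).isColored h hT (fun c hc d hd h₁ h₂ => ?_)
    fun c hc d hd h₁ h₂ => ?_⟩
  · let m : ν := ⟨(d.1.1, d.1.2 - 1), ν.up_left_mem le_rfl (Nat.sub_le _ _) d.2⟩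
    have hm : m ∈ ribbon T b a := mem_ribbon_of_between hT hs hc hd
      ⟨h₁.le, Nat.le_sub_one_of_lt h₂⟩ ⟨le_rfl, Nat.sub_le _ _⟩
    have hnext : Next (ribbon T b a) m d := ⟨hm, hd, .inl ⟨rfl, by simp only [m]; omega⟩⟩
    rw [Function.comp_apply, hτ m d hnext]
    exact hT.row_left h.1 hm hd rfl (by simp only [m]; omega)
  · let m : ν := ⟨(c.1.1 + 1, c.1.2), ν.up_left_mem h₂ h₁.le d.2⟩
    have hm : m ∈ ribbon T b a := mem_ribbon_of_between hT hs hc hd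
      ⟨Nat.le_succ _, le_rfl⟩ ⟨h₂, h₁.le⟩
    have hnext : Next (ribbon T b a) m c := ⟨hm, hc, .inr ⟨rfl, rfl⟩⟩
    rw [Function.comp_apply, hτ m c hnext]
    exact hT.col_lower h.1 hc hm rfl (Nat.lt_succ_self _)

theorem exists_refill_symm (h : DifferBySwap o o' b a) (hT : IsColored o' T) :
    ∃ T' : Filling N ν, IsColored o T' ∧ Refills b a T T' := by
  obtain ⟨τ, hτ, hcol⟩ := exists_refill h.flip (isColored_transposeFilling.mpr hT)
  obtain ⟨T', hT'⟩ := transposeFilling.surjective (transposeFilling T ∘ τ)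
  rw [← hT', isColored_transposeFilling] at hcol
  refine ⟨T', hcol, refills_transposeFilling.mp ?_⟩
  rw [hT']
  exact refills_comp hτ

end Tableaux

section Confluence

variable {N : ℕ} {ν : YoungDiagram} {o o' o₁ o₂ : ShuffleOrder N} {b a b' a' : Fin N}
  {T T' T₁ T₂ : Filling N ν}

theorem Refills.trans (h₁ : Refills b a T T₁) (h₂ : Refills b a T₁ T₂) : Refills b a T T₂ := by
  have h₂' := h₂
  simp only [Refills, h₁.ribbon_eq] at h₂'
  exact ⟨fun c hc => (h₂'.1 c hc).trans (h₁.1 c hc), fun c hc =>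
    ⟨(h₂'.2 c hc).1.trans (h₁.2 c hc).1, (h₂'.2 c hc).2.trans (h₁.2 c hc).2⟩⟩

theorem apply_eq_of_ncard_le {X α : Type*} [Finite X] {s : Set X} {f g : X → α} {c : X} {y : α}
    (hc : c ∈ s) (hne : ∀ d ∈ s, d ≠ c → f d = g d)
    (hcard : {d ∈ s | f d = y}.ncard ≤ {d ∈ s | g d = y}.ncard) (hy : f c = y) : g c = y := by
  by_contra hgc
  have hsub : {d ∈ s | g d = y} ⊆ {d ∈ s | f d = y} := fun d ⟨hd, hgd⟩ =>
    ⟨hd, (hne d hd fun hdc => hgc (hdc ▸ hgd)).trans hgd⟩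
  have hmem : c ∈ {d ∈ s | g d = y} :=
    (Set.eq_of_subset_of_ncard_le hsub hcard (Set.toFinite _)).ge ⟨hc, hy⟩
  exact hgc hmem.2

theorem Refills.eq_of_barred_lt (h : Refills b a T T') (hs : SameSide o b a)
    (hlt : o.lt (.barred a) (.unbarred b)) (hT : IsColored o T) (hT' : IsColored o T') :
    T = T' := by
  have forced : ∀ c d, Next (ribbon T b a) c d → T d = T' d := by
    rintro c d ⟨hc, hd, ⟨h₁, h₂⟩ | ⟨h₁, h₂⟩⟩
    · rw [hT.row_right hlt hc hd h₁ (by omega),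
        hT'.row_right hlt (h.ribbon_eq ▸ hc) (h.ribbon_eq ▸ hd) h₁ (by omega)]
    · rw [hT.col_upper hlt hd hc h₁.symm (by omega),
        hT'.col_upper hlt (h.ribbon_eq ▸ hd) (h.ribbon_eq ▸ hc) h₁.symm (by omega)]
  funext c
  by_cases hc : c ∈ ribbon T b a
  · by_contra hne
    have hother : ∀ d ∈ component (ribbon T b a) c, d ≠ c → T d = T' d := by
      intro d hd hdc
      rcases chain_of_mem_component (next_biUnique hT hs) hd with hchain | hchain <;>
        rcases hchain.cases_tail with e | ⟨x, _, hx⟩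
      exacts [absurd e hdc, forced x d hx, absurd e.symm hdc, absurd (forced x c hx) hne]
    have hmem := (component_equivalence (ribbon T b a)).refl c
    rcases id hc with hcb | hca
    · exact hne (hcb.trans (apply_eq_of_ncard_le hmem hother (h.2 c hc).1.ge hcb).symm)
    · exact hne (hca.trans (apply_eq_of_ncard_le hmem hother (h.2 c hc).2.ge hca).symm)
  · exact (h.1 c hc).symm

theorem Refills.eq_of_isColored (h : Refills b a T T') (hs : SameSide o b a)
    (hT : IsColored o T) (hT' : IsColored o T') : T = T' := by
  rcases o.lt_or_gt (by simp : (.barred a : Letter N) ≠ .unbarred b) with hlt | hlt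
  · exact h.eq_of_barred_lt hs hlt hT hT'
  · exact transposeFilling.injective ((refills_transposeFilling.mpr h).eq_of_barred_lt hs.flip hlt
      (isColored_transposeFilling.mpr hT) (isColored_transposeFilling.mpr hT'))

/-- A step of conversion which moves `ā` below `b`. -/
def SwapStep (b a : Fin N) (p q : ShuffleOrder N × Filling N ν) : Prop :=
  DifferBySwap p.1 q.1 b a ∧ IsColored p.1 p.2 ∧ IsColored q.1 q.2 ∧ Refills b a p.2 q.2

/-- A step of conversion which moves some barred letter down. -/
def DownStep (p q : ShuffleOrder N × Filling N ν) : Prop := ∃ b a, SwapStep b a p q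

theorem convertStep_iff {p q : ShuffleOrder N × Filling N ν} :
    ConvertStep p q ↔ DownStep p q ∨ DownStep q p := by
  constructor
  · rintro ⟨b, a, h₁ | h₁, h₂, h₃, h₄⟩
    exacts [.inl ⟨b, a, h₁, h₂, h₃, h₄⟩, .inr ⟨b, a, h₁, h₃, h₂, h₄.symm⟩]
  · rintro (⟨b, a, h₁, h₂, h₃, h₄⟩ | ⟨b, a, h₁, h₂, h₃, h₄⟩)
    exacts [⟨b, a, .inl h₁, h₂, h₃, h₄⟩, ⟨b, a, .inr h₁, h₃, h₂, h₄.symm⟩]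

namespace SwapStep
variable {p p₁ p₂ q : ShuffleOrder N × Filling N ν}

theorem right_unique (h₁ : SwapStep b a p p₁) (h₂ : SwapStep b a p p₂) : p₁ = p₂ := by
  have ho : p₁.1 = p₂.1 := h₁.1.right_unique h₂.1
  exact Prod.ext ho ((h₁.2.2.2.symm.trans h₂.2.2.2).eq_of_isColored h₁.1.sameSide_right h₁.2.2.1
    (ho ▸ h₂.2.2.1))

theorem left_unique (h₁ : SwapStep b a p₁ q) (h₂ : SwapStep b a p₂ q) : p₁ = p₂ := by
  have ho : p₁.1 = p₂.1 := h₁.1.left_unique h₂.1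
  exact Prod.ext ho ((h₁.2.2.2.trans h₂.2.2.2.symm).eq_of_isColored h₁.1.sameSide_left h₁.2.1
    (ho ▸ h₂.2.1))

end SwapStep

theorem notMem_swapPair_of_ne (hb : b ≠ b') (ha : a ≠ a') {x : Letter N}
    (hx : x ∈ swapPair b a) : x ∉ swapPair b' a' := by
  rcases hx with rfl | rfl <;> simp [swapPair, hb, ha]

theorem Refills.ribbon_eq_of_ne (h : Refills b a T T') (hb : b ≠ b') (ha : a ≠ a') :
    ribbon T' b' a' = ribbon T b' a' := by
  ext c
  rcases h.eq_or_mem_swapPair c with hc | ⟨hc, hc'⟩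
  · rw [mem_ribbon, mem_ribbon, hc]
  · exact iff_of_false (notMem_swapPair_of_ne hb ha hc') (notMem_swapPair_of_ne hb ha hc)

open Classical in
theorem Refills.piecewise (hb : b ≠ b') (ha : a ≠ a') (h₁ : Refills b a T T₁)
    (h₂ : Refills b' a' T T₂) : Refills b a T₂ ((ribbon T b a).piecewise T₁ T₂) := by
  have agree : ∀ d ∈ ribbon T b a, T₂ d = T d := fun d hd =>
    h₂.1 d (notMem_swapPair_of_ne hb ha hd)
  have ncard_eq (c : ν) (hc : c ∈ ribbon T b a) {F F' : Filling N ν} (x : Letter N)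
      (hF : ∀ d ∈ ribbon T b a, F d = F' d) : {d ∈ component (ribbon T b a) c | F d = x}.ncard =
        {d ∈ component (ribbon T b a) c | F' d = x}.ncard := by
    congr 1
    ext d
    exact and_congr_right fun hd => by rw [hF d (component_subset hc hd)]
  simp only [Refills, h₂.ribbon_eq_of_ne hb.symm ha.symm]
  refine ⟨fun c hc => Set.piecewise_eq_of_notMem _ _ _ hc, fun c hc => ?_⟩
  have agree' : ∀ d ∈ ribbon T b a, (ribbon T b a).piecewise T₁ T₂ d = T₁ d :=
    fun d hd => Set.piecewise_eq_of_mem _ _ _ hd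
  simp only [ncard_eq c hc _ agree', ncard_eq c hc _ agree]
  exact h₁.2 c hc

open Classical in
theorem Refills.piecewise_comm (hb : b ≠ b') (ha : a ≠ a') (h₁ : Refills b a T T₁)
    (h₂ : Refills b' a' T T₂) :
    (ribbon T b a).piecewise T₁ T₂ = (ribbon T b' a').piecewise T₂ T₁ := by
  funext c
  by_cases hc : c ∈ ribbon T b a
  · simp [hc, show c ∉ ribbon T b' a' from notMem_swapPair_of_ne hb ha hc]
  · by_cases hc' : c ∈ ribbon T b' a'
    · simp [hc, hc']
    · simp [hc, hc', h₁.1 c hc, h₂.1 c hc']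

theorem SwapStep.diamond {p p₁ p₂ : ShuffleOrder N × Filling N ν} (h₁ : SwapStep b a p p₁)
    (h₂ : SwapStep b' a' p p₂) (hne : ¬ (b = b' ∧ a = a')) :
    ∃ q, SwapStep b' a' p₁ q ∧ SwapStep b a p₂ q := by
  classical
  obtain ⟨hb, ha⟩ := h₁.1.ne_and_ne h₂.1 hne
  obtain ⟨o₃, ho₁, ho₂⟩ := h₁.1.diamond h₂.1 hne
  let T₃ : Filling N ν := (ribbon p.2 b a).piecewise p₁.2 p₂.2
  have hR₁ : Refills b' a' p₁.2 T₃ := by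
    simp only [T₃, h₁.2.2.2.piecewise_comm hb ha h₂.2.2.2]
    exact h₂.2.2.2.piecewise hb.symm ha.symm h₁.2.2.2
  have hR₂ : Refills b a p₂.2 T₃ := h₁.2.2.2.piecewise hb ha h₂.2.2.2
  have hT₃ (β : Bool) (c d : ν) (hcd₁ : p₁.1.Precedes β (p₁.2 c) (p₁.2 d))
      (hcd₂ : p₂.1.Precedes β (p₂.2 c) (p₂.2 d)) : o₃.Precedes β (T₃ c) (T₃ d) := by
    by_cases hcd : p₂.2 c ∈ swapPair b a ∧ p₂.2 d ∈ swapPair b a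
    · refine ho₁.precedes (hR₁.eq_or_mem_swapPair c) (hR₁.eq_or_mem_swapPair d) ?_ hcd₁
      have hc : c ∈ ribbon p₁.2 b a := by
        rw [h₁.2.2.2.ribbon_eq, ← h₂.2.2.2.ribbon_eq_of_ne hb.symm ha.symm]
        exact hcd.1
      exact fun h => notMem_swapPair_of_ne hb ha hc h.1
    · exact ho₂.precedes (hR₂.eq_or_mem_swapPair c) (hR₂.eq_or_mem_swapPair d) hcd hcd₂
  have hcol : IsColored o₃ T₃ := isColored_iff.mpr
    ⟨fun c d h h' => hT₃ true c d (h₁.2.2.1.row h h') (h₂.2.2.1.row h h'),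
      fun c d h h' => hT₃ false c d (h₁.2.2.1.col h h') (h₂.2.2.1.col h h')⟩
  exact ⟨(o₃, T₃), ⟨ho₁, h₁.2.2.1, hcol, hR₁⟩, ⟨ho₂, h₂.2.2.1, hcol, hR₂⟩⟩

theorem lt_of_downSteps {p q : ShuffleOrder N × Filling N ν} (h : ReflTransGen DownStep p q)
    (hp : p.1.lt (.barred a) (.unbarred b)) : q.1.lt (.barred a) (.unbarred b) := by
  induction h with
  | refl => exact hp
  | tail _ hs ih =>
    obtain ⟨d, c, hs, _⟩ := hs
    rw [ShuffleOrder.barred_lt_unbarred] at ih ⊢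
    exact fun hlt => ih (hs.unbarred_lt_barred_iff.mp hlt).1

theorem exchange_downSteps {p q p₁ : ShuffleOrder N × Filling N ν}
    (h : ReflTransGen DownStep p q) (h₁ : SwapStep b a p p₁)
    (hq : q.1.lt (.barred a) (.unbarred b)) : ReflTransGen DownStep p₁ q := by
  induction h using ReflTransGen.head_induction_on generalizing p₁ with
  | refl => exact absurd hq (q.1.asymm h₁.1.1)
  | head hs _ ih =>
    obtain ⟨d, c, hs⟩ := hs
    by_cases hdc : b = d ∧ a = c
    · obtain ⟨rfl, rfl⟩ := hdc
      rwa [h₁.right_unique hs]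
    · obtain ⟨r, hr, hr'⟩ := h₁.diamond hs hdc
      exact .head ⟨d, c, hr⟩ (ih hr')

theorem downSteps_unique {p : ShuffleOrder N × Filling N ν}
    (h₁ : ReflTransGen DownStep p (o, T₁)) (h₂ : ReflTransGen DownStep p (o, T₂)) : T₁ = T₂ := by
  induction h₁ using ReflTransGen.head_induction_on with
  | refl =>
    rcases h₂.cases_head with h | ⟨r, ⟨b, a, hr⟩, hr₂⟩
    · exact congrArg Prod.snd h
    · exact absurd (lt_of_downSteps hr₂ hr.1.2.1) (o.asymm hr.1.1)
  | head hs htail ih =>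
    obtain ⟨b, a, hs⟩ := hs
    have hlt := lt_of_downSteps htail hs.1.2.1
    exact ih (exchange_downSteps h₂ hs hlt)

theorem exists_swapStep (h : DifferBySwap o o' b a) (hT : IsColored o T) :
    ∃ T' : Filling N ν, SwapStep b a (o, T) (o', T') := by
  obtain ⟨τ, hτ, hT'⟩ := exists_refill h hT
  exact ⟨T ∘ τ, h, hT, hT', refills_comp hτ⟩

theorem exists_downSteps {r : ShuffleOrder N → ShuffleOrder N → Prop}
    (hr : ∀ o o', r o o' → ∃ b a, DifferBySwap o o' b a) (h : ReflTransGen r o o')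
    (hT : IsColored o T) : ∃ T', IsColored o' T' ∧
      ReflTransGen (fun p q : ShuffleOrder N × Filling N ν => DownStep p q ∧ r p.1 q.1)
        (o, T) (o', T') := by
  induction h with
  | refl => exact ⟨T, hT, .refl⟩
  | tail _ hs ih =>
    obtain ⟨T₁, hT₁, hsteps⟩ := ih
    obtain ⟨b, a, hba⟩ := hr _ _ hs
    obtain ⟨T₂, hstep⟩ := exists_swapStep hba hT₁
    exact ⟨T₂, hstep.2.2.1, hsteps.tail ⟨⟨b, a, hstep⟩, hs⟩⟩

theorem exists_downSteps_symm
    (h : ReflTransGen (fun o o' : ShuffleOrder N => ∃ b a, DifferBySwap o o' b a) o o')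
    (hT : IsColored o' T') :
    ∃ T : Filling N ν, IsColored o T ∧ ReflTransGen DownStep (o, T) (o', T') := by
  induction h using ReflTransGen.head_induction_on with
  | refl => exact ⟨T', hT, .refl⟩
  | head hs _ ih =>
    obtain ⟨b, a, hba⟩ := hs
    obtain ⟨T₁, hT₁, hsteps⟩ := ih
    obtain ⟨T₂, hT₂, hR⟩ := exists_refill_symm hba hT₁
    exact ⟨T₂, hT₂, .head ⟨b, a, hba, hT₂, hT₁, hR.symm⟩ hsteps⟩

theorem downSteps_of_downStep_right {p q : ShuffleOrder N × Filling N ν}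
    (hT : IsColored (bigBarOrder N) T) (h : ReflTransGen DownStep (bigBarOrder N, T) q)
    (hpq : DownStep p q) : ReflTransGen DownStep (bigBarOrder N, T) p := by
  obtain ⟨b, a, hpq⟩ := hpq
  obtain ⟨T₁, hT₁, hsteps⟩ := exists_downSteps (fun _ _ h => h) (reflTransGen_differBySwap p.1) hT
  have hsteps := ReflTransGen.mono (fun _ _ h => h.1) _ _ hsteps
  obtain ⟨T₂, hstep⟩ := exists_swapStep hpq.1 hT₁
  obtain rfl : T₂ = q.2 := downSteps_unique (hsteps.tail ⟨b, a, hstep⟩) h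
  exact hpq.left_unique hstep ▸ hsteps

theorem downSteps_of_convertSteps {q : ShuffleOrder N × Filling N ν}
    (hT : IsColored (bigBarOrder N) T) (h : ReflTransGen ConvertStep (bigBarOrder N, T) q) :
    ReflTransGen DownStep (bigBarOrder N, T) q := by
  induction h with
  | refl => exact .refl
  | tail _ hs ih =>
    rcases convertStep_iff.mp hs with hs | hs
    exacts [ih.tail hs, downSteps_of_downStep_right hT ih hs]

theorem convertsTo_of_downSteps (h : ReflTransGen DownStep (o, T) (o', T')) :
    ConvertsTo o o' T T' :=
  ReflTransGen.mono (fun _ _ h => convertStep_iff.mpr (.inl h)) _ _ h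

theorem convertsTo_unique (hT : IsColored (bigBarOrder N) T)
    (h₁ : ConvertsTo (bigBarOrder N) o T T₁) (h₂ : ConvertsTo (bigBarOrder N) o T T₂) :
    T₁ = T₂ :=
  downSteps_unique (downSteps_of_convertSteps hT h₁) (downSteps_of_convertSteps hT h₂)

end Confluence

section LocalPlactic

variable {M : Type*} [Monoid M]

theorem pow_mul_pow_mul_of_yyx {x y : M} (h : y * y * x = y * x * y) :
    ∀ {p k : ℕ}, p ≤ k → y ^ k * x ^ p * y = y ^ (k + 1) * x ^ p
  | 0, k, _ => by simp [pow_succ]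
  | p + 1, k + 1, hk =>
    have ih {l : ℕ} (hl : p ≤ l) := pow_mul_pow_mul_of_yyx h hl
    calc y ^ (k + 1) * x ^ (p + 1) * y = y ^ (k + 1) * x ^ p * (x * y) := by
          rw [pow_succ x]; simp only [mul_assoc]
      _ = y ^ k * x ^ p * (y * x * y) := by
          rw [← ih (by omega : p ≤ k)]; simp only [mul_assoc]
      _ = y ^ k * x ^ p * y * y * x := by rw [← h]; simp only [mul_assoc]
      _ = y ^ (k + 1 + 1) * x ^ (p + 1) := by
          rw [ih (by omega : p ≤ k), ih (by omega : p ≤ k + 1), pow_succ x, mul_assoc]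

theorem pow_mul_pow_of_zyy {y z : M} (h : z * y * y = y * z * y) {s n : ℕ} (hs : s ≤ n) :
    z ^ s * y ^ (n + 1) = y * z ^ s * y ^ n := by
  have hop := pow_mul_pow_mul_of_yyx (M := Mᵐᵒᵖ) (x := .op z) (y := .op y)
    (by simpa only [← MulOpposite.op_mul, ← mul_assoc] using congrArg MulOpposite.op h) hs
  apply MulOpposite.op_injective
  simpa only [MulOpposite.op_mul, MulOpposite.op_pow, ← mul_assoc] using hop.symm

theorem eq_filter_append_of_pairwise_le {α : Type*} [LinearOrder α] {l : List α}
    (hl : l.Pairwise (· ≤ ·)) (b : α) :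
    l = l.filter (· < b) ++ (List.replicate (l.count b) b ++ l.filter (b < ·)) := by
  refine List.Perm.eq_of_pairwise (fun x y _ _ => le_antisymm) hl ?_ ?_
  · simp only [List.pairwise_append, List.pairwise_replicate, hl.filter, List.mem_filter,
      List.mem_append, List.mem_replicate, decide_eq_true_eq]
    grind
  · rw [List.perm_iff_count]
    intro x
    have hcount (p : α → Bool) : (l.filter p).count x = if p x then l.count x else 0 := by
      split_ifs with h
      exacts [List.count_filter h, List.count_eq_zero.mpr fun hx => h (List.of_mem_filter hx)]
    simp only [List.count_append, hcount, List.count_replicate, beq_iff_eq, decide_eq_true_eq]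
    rcases lt_trichotomy x b with h | rfl | h
    · simp [h, h.not_gt, h.ne']
    · simp
    · simp [h, h.not_gt, h.ne]

/-- The relations of the local plactic monoid for the images `g 0, g 1, …` of its generators in
a monoid. -/
structure LocalPlactic (g : ℕ → M) : Prop where
  comm : ∀ x z, x + 2 ≤ z → g x * g z = g z * g x
  yyx : ∀ x, g (x + 1) * g (x + 1) * g x = g (x + 1) * g x * g (x + 1)
  zyy : ∀ y, g (y + 1) * g y * g y = g y * g (y + 1) * g y

namespace LocalPlactic
variable {g : ℕ → M} {b : ℕ} {l lo hi : List ℕ} {k n : ℕ}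

theorem commute (hg : LocalPlactic g) {x z : ℕ} (h : x + 2 ≤ z ∨ z + 2 ≤ x) :
    Commute (g x) (g z) :=
  h.elim (hg.comm x z) fun h => (hg.comm z x h).symm

theorem commute_prod (hg : LocalPlactic g) {x : ℕ} (h : ∀ z ∈ l, x + 2 ≤ z ∨ z + 2 ≤ x) :
    Commute (g x) (l.map g).prod :=
  Commute.list_prod_right _ _ fun y hy => by
    obtain ⟨z, hz, rfl⟩ := List.mem_map.mp hy
    exact hg.commute (h z hz)

theorem pow_mul_prod_mul (hg : LocalPlactic g) (hl : l.Pairwise (· ≤ ·)) (hb : ∀ x ∈ l, x < b)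
    (hk : l.count (b - 1) ≤ k) :
    g b ^ k * (l.map g).prod * g b = g b ^ (k + 1) * (l.map g).prod := by
  cases b with
  | zero =>
    obtain rfl : l = [] := List.eq_nil_iff_forall_not_mem.mpr fun x hx => by simpa using hb x hx
    simp [pow_succ]
  | succ a =>
    rw [Nat.add_sub_cancel] at hk
    have hnil : l.filter (a < ·) = [] :=
      List.filter_eq_nil_iff.mpr fun x hx => by
        have := hb x hx
        simp only [decide_eq_true_eq]
        omega
    have hprod : (l.map g).prod = ((l.filter (· < a)).map g).prod * g a ^ l.count a := by
      conv_lhs => rw [eq_filter_append_of_pairwise_le hl a, hnil]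
      simp
    have hcomm (m : ℕ) := (hg.commute_prod (x := a + 1) (l := l.filter (· < a))
      fun z hz => .inr (by have := List.of_mem_filter hz; grind)).pow_left m
    rw [hprod]
    generalize ((l.filter (· < a)).map g).prod = P at *
    calc g (a + 1) ^ k * (P * g a ^ l.count a) * g (a + 1)
        = P * (g (a + 1) ^ k * g a ^ l.count a * g (a + 1)) := by
          rw [← mul_assoc, (hcomm k).eq]; simp only [mul_assoc]
      _ = P * (g (a + 1) ^ (k + 1) * g a ^ l.count a) := by
          rw [pow_mul_pow_mul_of_yyx (hg.yyx a) hk]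
      _ = g (a + 1) ^ (k + 1) * (P * g a ^ l.count a) := by
          rw [← mul_assoc, ← (hcomm (k + 1)).eq, mul_assoc]

theorem prod_mul_pow (hg : LocalPlactic g) (hl : l.Pairwise (· ≤ ·)) (hb : ∀ x ∈ l, b < x)
    (hn : l.count (b + 1) ≤ n) :
    (l.map g).prod * g b ^ (n + 1) = g b * (l.map g).prod * g b ^ n := by
  have hnil : l.filter (· < b + 1) = [] :=
    List.filter_eq_nil_iff.mpr fun x hx => by
      have := hb x hx
      simp only [decide_eq_true_eq]
      omega
  have hprod : (l.map g).prod =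
      g (b + 1) ^ l.count (b + 1) * ((l.filter (b + 1 < ·)).map g).prod := by
    conv_lhs => rw [eq_filter_append_of_pairwise_le hl (b + 1), hnil]
    simp
  have hcomm (m : ℕ) := (hg.commute_prod (x := b) (l := l.filter (b + 1 < ·))
    fun z hz => .inl (by have := List.of_mem_filter hz; grind)).pow_left m
  rw [hprod, mul_assoc, ← (hcomm (n + 1)).eq, ← mul_assoc, pow_mul_pow_of_zyy (hg.zyy b) hn,
    mul_assoc _ (g b ^ n), (hcomm n).eq]
  simp only [mul_assoc]

theorem transfer (hg : LocalPlactic g) (hlo : lo.Pairwise (· ≤ ·)) (hhi : hi.Pairwise (· ≤ ·))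
    (hlo' : ∀ x ∈ lo, x < b) (hhi' : ∀ x ∈ hi, b < x) (hk : lo.count (b - 1) ≤ k)
    (hn : hi.count (b + 1) ≤ n) :
    g b ^ k * (hi.map g).prod * (lo.map g).prod * g b ^ (n + 1) =
      g b ^ (k + 1) * (hi.map g).prod * (lo.map g).prod * g b ^ n := by
  have hcomm : Commute (hi.map g).prod (lo.map g).prod :=
    Commute.list_prod_left _ _ fun y hy => by
      obtain ⟨x, hx, rfl⟩ := List.mem_map.mp hy
      exact hg.commute_prod fun z hz => .inr (by have := hlo' z hz; have := hhi' x hx; omega)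
  rw [mul_assoc _ (hi.map g).prod, mul_assoc _ (hi.map g).prod, hcomm.eq]
  calc g b ^ k * ((lo.map g).prod * (hi.map g).prod) * g b ^ (n + 1)
      = g b ^ k * (lo.map g).prod * ((hi.map g).prod * g b ^ (n + 1)) := by simp only [mul_assoc]
    _ = (g b ^ k * (lo.map g).prod * g b) * ((hi.map g).prod * g b ^ n) := by
        rw [hg.prod_mul_pow hhi hhi' hn]; simp only [mul_assoc]
    _ = g b ^ (k + 1) * ((lo.map g).prod * (hi.map g).prod) * g b ^ n := by
        rw [hg.pow_mul_prod_mul hlo hlo' hk]; simp only [mul_assoc]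

end LocalPlactic

end LocalPlactic

section Rows

variable {N : ℕ} {ν : YoungDiagram} {o o' : ShuffleOrder N} {b a : Fin N} {T T' : Filling N ν}

/-- The number of letters `x` in row `i`. -/
noncomputable def rowCount (T : Filling N ν) (i : ℕ) (x : Letter N) : ℕ :=
  {c : ν | c.1.1 = i ∧ T c = x}.ncard

/-- The number of letters `x` in the rows `0, …, i`. -/
noncomputable def rowsCount (T : Filling N ν) (i : ℕ) (x : Letter N) : ℕ :=
  {c : ν | c.1.1 ≤ i ∧ T c = x}.ncard

theorem rowsCount_zero (T : Filling N ν) (x : Letter N) : rowsCount T 0 x = rowCount T 0 x := by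
  simp only [rowsCount, rowCount, Nat.le_zero]

theorem rowsCount_succ (T : Filling N ν) (i : ℕ) (x : Letter N) :
    rowsCount T (i + 1) x = rowsCount T i x + rowCount T (i + 1) x := by
  rw [rowsCount, rowsCount, rowCount, ← Set.ncard_union_eq _ (Set.toFinite _) (Set.toFinite _)]
  · simp only [Nat.le_succ_iff, or_and_right]
    rfl
  · rw [Set.disjoint_left]
    rintro c ⟨h, -⟩ ⟨h', -⟩
    omega

theorem rowCount_eq_ncard_columns (T : Filling N ν) (i : ℕ) (x : Letter N) :
    rowCount T i x = {j | ∃ h : (i, j) ∈ ν, T ⟨(i, j), h⟩ = x}.ncard := by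
  have hinj : Set.InjOn (fun c : ν => c.1.2) {c : ν | c.1.1 = i ∧ T c = x} :=
    fun c hc d hd h => Subtype.ext (Prod.ext (hc.1.trans hd.1.symm) h)
  rw [rowCount, ← hinj.ncard_image]
  congr 1
  ext j
  constructor
  · rintro ⟨⟨⟨i, j⟩, h⟩, ⟨rfl, hx⟩, rfl⟩
    exact ⟨h, hx⟩
  · rintro ⟨h, hx⟩
    exact ⟨⟨(i, j), h⟩, ⟨rfl, hx⟩, rfl⟩

theorem lt_rowLen_zero {i j : ℕ} (h : (i, j) ∈ ν) : j < ν.rowLen 0 :=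
  (YoungDiagram.mem_iff_lt_rowLen.mp h).trans_le (ν.rowLen_anti 0 i (Nat.zero_le i))

theorem lt_colLen_zero {i j : ℕ} (h : (i, j) ∈ ν) : i < ν.colLen 0 :=
  (YoungDiagram.mem_iff_lt_colLen.mp h).trans_le (ν.colLen_anti 0 j (Nat.zero_le j))

theorem rowCount_le_rowCount {i i' : ℕ} {x y : Letter N}
    (h : ∀ c : ν, c.1.1 = i → T c = x → ∃ h : (i', c.1.2) ∈ ν, T' ⟨(i', c.1.2), h⟩ = y) :
    rowCount T i x ≤ rowCount T' i' y := by
  rw [rowCount_eq_ncard_columns, rowCount_eq_ncard_columns]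
  refine Set.ncard_le_ncard (fun j ⟨hj, hx⟩ => h _ rfl hx) ?_
  exact (Set.finite_lt_nat (ν.rowLen 0)).subset fun j ⟨hj, _⟩ => lt_rowLen_zero hj

theorem IsColored.rowCount_barred_le_one (hT : IsColored o T) (i : ℕ) :
    rowCount T i (.barred a) ≤ 1 := by
  have hle (c d : ν) (hc : c.1.1 = i ∧ T c = .barred a) (hd : d.1.1 = i ∧ T d = .barred a) :
      d.1.2 ≤ c.1.2 := by
    by_contra! hlt
    exact hT.row_strict c d (hc.1.trans hd.1.symm) hlt (by rw [hc.2]; rfl) (hc.2.trans hd.2.symm)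
  exact (Set.ncard_le_one (Set.toFinite _)).mpr fun c hc d hd =>
    Subtype.ext (Prod.ext (hc.1.trans hd.1.symm) ((hle d c hd hc).antisymm (hle c d hc hd)))

theorem Refills.rowCount_add (h : Refills b a T T') (i : ℕ) :
    rowCount T i (.unbarred b) + rowCount T i (.barred a) =
      rowCount T' i (.unbarred b) + rowCount T' i (.barred a) := by
  refine (ncard_swapPair T {c | c.1.1 = i}).symm.trans
    (Eq.trans ?_ (ncard_swapPair T' {c | c.1.1 = i}))
  simp only [← mem_ribbon, h.ribbon_eq]

/-- The boxes of `R` in row `i` are connected to those in row `i + 1`. -/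
def RowsLinked (R : Set ν) (i : ℕ) : Prop :=
  ∃ c ∈ R, ∃ d ∈ R, c.1.1 = i ∧ d.1.1 = i + 1 ∧ c.1.2 = d.1.2

theorem row_le_iff_of_mem_component {R : Set ν} {i : ℕ} (hi : ¬ RowsLinked R i) {c d : ν}
    (h : d ∈ component R c) : d.1.1 ≤ i ↔ c.1.1 ≤ i := by
  induction h with
  | refl => rfl
  | @tail d d' _ hs ih =>
    rw [← ih]
    obtain ⟨hd, hd', ⟨h, -⟩ | ⟨h, h' | h'⟩⟩ := hs
    · rw [h]
    · have : d.1.1 ≠ i := fun hdi => hi ⟨d, hd, d', hd', hdi, by omega, h⟩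
      omega
    · have : d'.1.1 ≠ i := fun hdi => hi ⟨d', hd', d, hd, hdi, by omega, h.symm⟩
      omega

theorem SwapStep.exists_perm (h : SwapStep b a (o, T) (o', T')) :
    ∃ τ : Equiv.Perm ν, (∀ d, τ d ∈ component (ribbon T b a) d) ∧ T' = T ∘ τ := by
  obtain ⟨τ, hτ, hT'⟩ := exists_refill h.1 h.2.1
  have hstep : SwapStep b a (o, T) (o', T ∘ τ) := ⟨h.1, h.2.1, hT', refills_comp hτ⟩
  exact ⟨τ, hτ, congrArg Prod.snd (h.right_unique hstep)⟩

theorem SwapStep.rowsCount_eq (h : SwapStep b a (o, T) (o', T')) {i : ℕ}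
    (hi : ¬ RowsLinked (ribbon T b a) i) (x : Letter N) : rowsCount T i x = rowsCount T' i x := by
  obtain ⟨τ, hτ, rfl⟩ := h.exists_perm
  exact (ncard_comp_perm (s := {c : ν | c.1.1 ≤ i})
    (fun c => row_le_iff_of_mem_component hi (hτ c)) T x).symm

theorem one_le_rowCount {x : Letter N} {c : ν} (h : T c = x) : 1 ≤ rowCount T c.1.1 x :=
  (Set.ncard_pos (Set.toFinite _)).mpr ⟨c, rfl, h⟩

/-- In linked rows, the lower row of `T` and the upper row of `T'` contain `ā`, so at most one `b`
crosses from one row to the next. -/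
theorem SwapStep.rowsCount_transfer (h : SwapStep b a (o, T) (o', T')) (i : ℕ) :
    rowsCount T i (.unbarred b) = rowsCount T' i (.unbarred b) ∨
      rowsCount T i (.unbarred b) = rowsCount T' i (.unbarred b) + 1 ∧
        RowsLinked (ribbon T b a) i := by
  by_cases hi : RowsLinked (ribbon T b a) i
  swap
  · exact .inl (h.rowsCount_eq hi _)
  obtain ⟨hlt, hT, hT', hR⟩ :
      DifferBySwap o o' b a ∧ IsColored o T ∧ IsColored o' T' ∧ Refills b a T T' := h
  have hsum (i : ℕ) := hR.rowCount_add i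
  have hle (i : ℕ) := hT.rowCount_barred_le_one (a := a) i
  have hupper : rowCount T' i (.barred a) = 1 := by
    obtain ⟨c, hc, d, hd, rfl, hd₁, hcd⟩ := hi
    exact (hT'.rowCount_barred_le_one _).antisymm (one_le_rowCount
      (hT'.col_upper hlt.2.1 (hR.ribbon_eq ▸ hc) (hR.ribbon_eq ▸ hd) hcd (by omega)))
  cases i with
  | zero =>
    rw [rowsCount_zero, rowsCount_zero]
    specialize hsum 0
    specialize hle 0
    simp only [hi, and_true]
    omega
  | succ i =>
    rw [rowsCount_succ, rowsCount_succ]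
    have hsum' := hsum (i + 1)
    have hle' := hle (i + 1)
    simp only [hi, and_true]
    rcases SwapStep.rowsCount_transfer ⟨hlt, hT, hT', hR⟩ i with
      h | ⟨h, c, hc, d, hd, hc₁, hd₁, hcd⟩
    · omega
    · have hlower := one_le_rowCount (hT.col_lower hlt.1 hc hd hcd (by omega))
      rw [hd₁] at hlower
      omega

theorem ClearAround.eq_of_lt_barred (hclear : ClearAround o o' b) (h : DifferBySwap o o' b a)
    {x : Fin N} (hx : x.val + 1 = b.val) {y : Letter N} (hxy : o.lt (.unbarred x) y)
    (hya : o.lt y (.barred a)) : y = .unbarred b := by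
  by_contra hyb
  have hlt := (h.sameSide_left y hyb fun hya' => o.irrefl _ (hya' ▸ hya)).mpr hya
  rcases y with y | y
  · rw [o.unbarred_lt_unbarred] at hxy hlt
    omega
  · exact o.asymm hlt (hclear.below x y hx hxy)

theorem ClearAround.eq_of_barred_lt (hclear : ClearAround o o' b) (h : DifferBySwap o o' b a)
    {z : Fin N} (hz : b.val + 1 = z.val) {y : Letter N} (hay : o'.lt (.barred a) y)
    (hyz : o'.lt y (.unbarred z)) : y = .unbarred b := by
  by_contra hyb
  have hnotMem : y ∉ swapPair b a := by
    rintro (hy | rfl)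
    exacts [hyb hy, o'.irrefl _ hay]
  have hlt := (h.sameSide_right.lt_iff_right hnotMem (.inr rfl) (.inl rfl)).mp hay
  rcases y with y | y
  · rw [o'.unbarred_lt_unbarred] at hyz hlt
    omega
  · exact o'.asymm hyz (hclear.above z y hz hlt)

theorem IsColored.lt_of_col (hT : IsColored o T) {c d : ν} (h₁ : c.1.2 = d.1.2)
    (h₂ : c.1.1 < d.1.1) {x : Fin N} (hx : T c = .unbarred x ∨ T d = .unbarred x) :
    o.lt (T c) (T d) := by
  rcases hT.col h₁ h₂ with h | ⟨h, hbar⟩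
  · exact h
  · rcases hx with hx | hx
    · exact absurd (by rw [hx]; rfl) hbar
    · exact absurd (by rw [h, hx]; rfl) hbar

theorem IsColored.lt_of_row (hT : IsColored o T) {c d : ν} (h₁ : c.1.1 = d.1.1)
    (h₂ : c.1.2 < d.1.2) {x : Fin N} (hx : T c = .barred x ∨ T d = .barred x) :
    o.lt (T c) (T d) := by
  rcases hT.row h₁ h₂ with h | ⟨h, hbar⟩
  · exact h
  · rcases hx with hx | hx
    · exact absurd (by rw [hx]; rfl) hbar
    · exact absurd (by rw [h, hx]; rfl) hbar

theorem IsColored.col_lt_of_lt (hT : IsColored o T) {c d : ν} (h₁ : c.1.1 ≤ d.1.1)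
    (h : o.lt (T d) (T c)) : d.1.2 < c.1.2 := by
  by_contra! hle
  exact (hT.rank_mono (Prod.mk_le_mk.mpr ⟨h₁, hle⟩ : c.1 ≤ d.1)).not_gt (o.rank_lt_rank h)

theorem SwapStep.rowCount_pred_le (h : SwapStep b a (o, T) (o', T')) (hclear : ClearAround o o' b)
    {i : ℕ} (hi : RowsLinked (ribbon T b a) i) {x : Fin N} (hx : x.val + 1 = b.val) :
    rowCount T i (.unbarred x) ≤ rowCount T (i + 1) (.unbarred b) := by
  obtain ⟨hlt, hT, -⟩ : DifferBySwap o o' b a ∧ IsColored o T ∧ _ := h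
  obtain ⟨c, hc, d, hd, rfl, hd₁, hcd⟩ := hi
  have hda : T d = .barred a := hT.col_lower hlt.1 hc hd hcd (by omega)
  have hxb : o.lt (.unbarred x) (.unbarred b) := o.unbarred_lt _ _ (Fin.lt_def.mpr (by omega))
  refine rowCount_le_rowCount fun m hm hmx => ?_
  have hxc : o.lt (T m) (T c) := by
    rw [hmx]
    rcases hc with hc | hc <;> rw [hc]
    exacts [hxb, o.trans hxb hlt.1]
  have hmc : m.1.2 < c.1.2 := hT.col_lt_of_lt hm.ge hxc
  let m₂ : ν := ⟨(c.1.1 + 1, m.1.2), ν.up_left_mem hd₁.ge (hcd ▸ hmc.le) d.2⟩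
  have hxm₂ : o.lt (T m) (T m₂) :=
    hT.lt_of_col (c := m) (d := m₂) rfl (hm ▸ Nat.lt_succ_self _) (.inl hmx)
  have hm₂a : o.lt (T m₂) (T d) := hT.lt_of_row (c := m₂) (d := d) hd₁.symm (hcd ▸ hmc) (.inr hda)
  exact ⟨m₂.2, hclear.eq_of_lt_barred hlt hx (hmx ▸ hxm₂) (hda ▸ hm₂a)⟩

theorem SwapStep.rowCount_succ_le (h : SwapStep b a (o, T) (o', T')) (hclear : ClearAround o o' b)
    {i : ℕ} (hi : RowsLinked (ribbon T b a) i) {z : Fin N} (hz : b.val + 1 = z.val) :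
    rowCount T (i + 1) (.unbarred z) ≤ rowCount T' i (.unbarred b) := by
  obtain ⟨hlt, -, hT', hR⟩ :
      DifferBySwap o o' b a ∧ IsColored o T ∧ IsColored o' T' ∧ Refills b a T T' := h
  rw [← hR.ribbon_eq] at hi
  obtain ⟨c, hc, d, hd, rfl, hd₁, hcd⟩ := hi
  have hca : T' c = .barred a := hT'.col_upper hlt.2.1 hc hd hcd (by omega)
  have hbz : o'.lt (.unbarred b) (.unbarred z) := o'.unbarred_lt _ _ (Fin.lt_def.mpr (by omega))
  refine rowCount_le_rowCount fun m hm hmz => ?_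
  have hmR : m ∉ ribbon T b a := by
    rw [mem_ribbon, hmz]
    rintro (hzb | hza)
    · exact o'.irrefl _ (hzb ▸ hbz)
    · cases hza
  rw [← hR.1 m hmR] at hmz
  have hdz : o'.lt (T' d) (T' m) := by
    rw [hmz]
    rcases hd with hd | hd <;> rw [hd]
    exacts [hbz, o'.trans hlt.2.1 hbz]
  have hdm : d.1.2 < m.1.2 := hT'.col_lt_of_lt (hm.trans hd₁.symm).le hdz
  let m₂ : ν := ⟨(c.1.1, m.1.2), ν.up_left_mem (hm ▸ Nat.le_succ _) le_rfl m.2⟩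
  have ham₂ : o'.lt (T' c) (T' m₂) := hT'.lt_of_row (c := c) (d := m₂) rfl (hcd ▸ hdm) (.inl hca)
  have hm₂z : o'.lt (T' m₂) (T' m) :=
    hT'.lt_of_col (c := m₂) (d := m) rfl (hm ▸ Nat.lt_succ_self _) (.inr hmz)
  exact ⟨m₂.2, hclear.eq_of_barred_lt hlt hz (hca ▸ ham₂) (hmz ▸ hm₂z)⟩

end Rows

section Products

variable {M : Type*} [Monoid M]

/-- The product of `F (n - 1), …, F 1, F 0`. -/
def descProd (F : ℕ → M) (n : ℕ) : M :=
  ((List.range n).reverse.map F).prod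

theorem descProd_succ (F : ℕ → M) (n : ℕ) : descProd F (n + 1) = F n * descProd F n := by
  simp [descProd, List.range_succ]

theorem descProd_transfer {y : M} {A C : ℕ → M} {m m' t : ℕ → ℕ}
    (hzero : m 0 = m' 0 + t 0) (hsucc : ∀ i, m (i + 1) + t i = m' (i + 1) + t (i + 1))
    (ht : ∀ i, t i = 0 ∨ t i = 1 ∧ y ^ m (i + 1) * C (i + 1) * A i * y ^ (m' i + 1) =
      y ^ (m (i + 1) + 1) * C (i + 1) * A i * y ^ m' i) (n : ℕ) :
    descProd (fun i => A i * y ^ m i * C i) (n + 1) =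
      A n * y ^ (m' n + t n) * C n * descProd (fun i => A i * y ^ m' i * C i) n := by
  induction n with
  | zero => rw [descProd_succ, hzero]; rfl
  | succ n ih =>
    have hmove : y ^ m (n + 1) * C (n + 1) * A n * y ^ (m' n + t n) =
        y ^ (m (n + 1) + t n) * C (n + 1) * A n * y ^ m' n := by
      rcases ht n with h | ⟨h, hy⟩
      · rw [h, add_zero, add_zero]
      · rwa [h]
    rw [descProd_succ, ih, descProd_succ, ← hsucc n]
    calc A (n + 1) * y ^ m (n + 1) * C (n + 1) * (A n * y ^ (m' n + t n) * C n *
          descProd (fun i => A i * y ^ m' i * C i) n)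
        = A (n + 1) * (y ^ m (n + 1) * C (n + 1) * A n * y ^ (m' n + t n)) * C n *
          descProd (fun i => A i * y ^ m' i * C i) n := by simp only [mul_assoc]
      _ = _ := by rw [hmove]; simp only [mul_assoc]

end Products

section UnbarredRows

variable {N : ℕ} {ν : YoungDiagram} {o o' : ShuffleOrder N} {b a : Fin N} {T T' : Filling N ν}
  {M : Type*} [Monoid M] {g : ℕ → M}

/-- The number of an unbarred letter. -/
def Letter.unbarred? : Letter N → Option ℕ
  | .unbarred a => some a.val
  | .barred _ => none

/-- The number of the letter in box `(i, j)`, if the box is in `ν` and the letter is unbarred. -/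
def unbarredAt (T : Filling N ν) (i j : ℕ) : Option ℕ :=
  if h : (i, j) ∈ ν then (T ⟨(i, j), h⟩).unbarred? else none

/-- The numbers of the unbarred letters in row `i`, from left to right. -/
def unbarredRow (T : Filling N ν) (i : ℕ) : List ℕ :=
  (List.range (ν.rowLen 0)).filterMap (unbarredAt T i)

theorem unbarredAt_eq_some {i j m : ℕ} : unbarredAt T i j = some m ↔
    ∃ x : Fin N, x.val = m ∧ ∃ h : (i, j) ∈ ν, T ⟨(i, j), h⟩ = .unbarred x := by
  unfold unbarredAt
  split_ifs with h
  · cases hc : T ⟨(i, j), h⟩ <;> simp [Letter.unbarred?, h, hc, eq_comm]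
  · simp [h]

theorem unbarredAt_eq_some_val {i j : ℕ} : unbarredAt T i j = some b.val ↔
    ∃ h : (i, j) ∈ ν, T ⟨(i, j), h⟩ = .unbarred b := by
  rw [unbarredAt_eq_some]
  exact ⟨fun ⟨x, hx, h⟩ => Fin.ext hx ▸ h, fun h => ⟨b, rfl, h⟩⟩

theorem unbarredRow_pairwise (hT : IsColored o T) (i : ℕ) :
    (unbarredRow T i).Pairwise (· ≤ ·) := by
  rw [unbarredRow, List.pairwise_filterMap]
  refine List.pairwise_lt_range.imp fun {j k} hjk x hx y hy => ?_
  obtain ⟨x, rfl, hj, hx⟩ := unbarredAt_eq_some.mp hx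
  obtain ⟨y, rfl, hk, hy⟩ := unbarredAt_eq_some.mp hy
  rcases hT.row_weak ⟨_, hj⟩ ⟨_, hk⟩ rfl hjk with h | h <;> rw [hx, hy] at h
  · cases h
    exact le_rfl
  · exact ((o.unbarred_lt_unbarred).mp h).le

theorem unbarredRow_colLen (T : Filling N ν) : unbarredRow T (ν.colLen 0) = [] :=
  List.filterMap_eq_nil_iff.mpr fun _ _ => dif_neg fun h => (lt_colLen_zero h).false

theorem count_unbarredRow (T : Filling N ν) (i : ℕ) (x : Fin N) :
    (unbarredRow T i).count x.val = rowCount T i (.unbarred x) := by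
  rw [unbarredRow, List.count, List.countP_filterMap, List.countP_eq_length_filter,
    ← List.toFinset_card_of_nodup (List.nodup_range.filter _), ← Set.ncard_coe_finset,
    rowCount_eq_ncard_columns]
  congr 1
  ext j
  have hval : (Option.map (· == x.val) (unbarredAt T i j)).getD false = true ↔
      unbarredAt T i j = some x.val := by
    cases unbarredAt T i j <;> simp
  rw [List.coe_toFinset, Set.mem_ofPred_eq, List.mem_filter, List.mem_range, hval,
    unbarredAt_eq_some_val]
  exact and_iff_right_of_imp fun ⟨hj, _⟩ => lt_rowLen_zero hj

theorem count_unbarredRow_le {i m n : ℕ}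
    (h : ∀ x : Fin N, x.val = m → rowCount T i (.unbarred x) ≤ n) :
    (unbarredRow T i).count m ≤ n := by
  by_cases hm : m ∈ unbarredRow T i
  · obtain ⟨j, -, hj⟩ := List.mem_filterMap.mp hm
    obtain ⟨x, rfl, -⟩ := unbarredAt_eq_some.mp hj
    exact (count_unbarredRow T i x).trans_le (h x rfl)
  · exact (List.count_eq_zero.mpr hm).trans_le (Nat.zero_le n)

theorem Refills.filter_unbarredRow (h : Refills b a T T') (i : ℕ) {p : ℕ → Bool}
    (hp : p b = false) : (unbarredRow T i).filter p = (unbarredRow T' i).filter p := by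
  have hnone (F : Filling N ν) {c : ν} (hc : c ∈ ribbon F b a) :
      (F c).unbarred?.filter p = none := by
    rcases hc with hc | hc <;> simp [hc, Letter.unbarred?, hp]
  rw [unbarredRow, unbarredRow, List.filter_filterMap, List.filter_filterMap]
  congr 1
  funext j
  unfold unbarredAt
  split_ifs with hj
  · by_cases hR : (⟨(i, j), hj⟩ : ν) ∈ ribbon T b a
    · rw [hnone T hR, hnone T' (h.ribbon_eq ▸ hR)]
    · rw [h.1 _ hR]
  · rfl

theorem IsColored.prod_unbarredRow (hT : IsColored o T) (g : ℕ → M) (b : Fin N) (i : ℕ) :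
    ((unbarredRow T i).map g).prod =
      (((unbarredRow T i).filter (· < b.val)).map g).prod * g b ^ rowCount T i (.unbarred b) *
        (((unbarredRow T i).filter (b.val < ·)).map g).prod := by
  conv_lhs => rw [eq_filter_append_of_pairwise_le (unbarredRow_pairwise hT i) b]
  simp [mul_assoc, count_unbarredRow]

theorem SwapStep.prod_transfer (hg : LocalPlactic g) (h : SwapStep b a (o, T) (o', T'))
    (hclear : ClearAround o o' b) {i : ℕ} (hi : RowsLinked (ribbon T b a) i) :
    g b ^ rowCount T (i + 1) (.unbarred b) *
        (((unbarredRow T (i + 1)).filter (b.val < ·)).map g).prod *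
        (((unbarredRow T i).filter (· < b.val)).map g).prod *
        g b ^ (rowCount T' i (.unbarred b) + 1) =
      g b ^ (rowCount T (i + 1) (.unbarred b) + 1) *
        (((unbarredRow T (i + 1)).filter (b.val < ·)).map g).prod *
        (((unbarredRow T i).filter (· < b.val)).map g).prod *
        g b ^ rowCount T' i (.unbarred b) := by
  refine hg.transfer ((unbarredRow_pairwise h.2.1 i).filter _)
    ((unbarredRow_pairwise h.2.1 (i + 1)).filter _) (by simp) (by simp) ?_ ?_
  · rcases Nat.eq_zero_or_pos b.val with hb | hb
    · simp [hb]
    · exact (List.filter_sublist.count_le _).trans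
        (count_unbarredRow_le fun x hx => h.rowCount_pred_le hclear hi (by omega))
  · exact (List.filter_sublist.count_le _).trans
      (count_unbarredRow_le fun z hz => h.rowCount_succ_le hclear hi hz.symm)

theorem SwapStep.descProd_unbarredRow_eq (hg : LocalPlactic g)
    (h : SwapStep b a (o, T) (o', T')) (hclear : ClearAround o o' b) :
    descProd (fun i => ((unbarredRow T i).map g).prod) (ν.colLen 0) =
      descProd (fun i => ((unbarredRow T' i).map g).prod) (ν.colLen 0) := by
  have hT : IsColored o T := h.2.1
  have hT' : IsColored o' T' := h.2.2.1
  have hR : Refills b a T T' := h.2.2.2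
  have hcarry (i : ℕ) : ∃ t, rowsCount T i (.unbarred b) = rowsCount T' i (.unbarred b) + t ∧
      (t = 0 ∨ t = 1 ∧ RowsLinked (ribbon T b a) i) := by
    rcases h.rowsCount_transfer i with h | ⟨h, hi⟩
    exacts [⟨0, h, .inl rfl⟩, ⟨1, h, .inr ⟨rfl, hi⟩⟩]
  choose t hcount ht using hcarry
  have hlast : t (ν.colLen 0) = 0 := by
    refine (ht _).resolve_right fun ⟨_, c, _, _, _, hc, _⟩ => ?_
    exact (lt_colLen_zero c.2).ne hc
  have hprod' (i : ℕ) : ((unbarredRow T' i).map g).prod =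
      (((unbarredRow T i).filter (· < b.val)).map g).prod * g b ^ rowCount T' i (.unbarred b) *
        (((unbarredRow T i).filter (b.val < ·)).map g).prod := by
    rw [hT'.prod_unbarredRow g b, hR.filter_unbarredRow i (decide_eq_false (lt_irrefl b.val)),
      hR.filter_unbarredRow i (decide_eq_false (lt_irrefl b.val))]
  have key := descProd_transfer (t := t) (y := g b)
    (m := fun i => rowCount T i (.unbarred b)) (m' := fun i => rowCount T' i (.unbarred b))
    (A := fun i => (((unbarredRow T i).filter (· < b.val)).map g).prod)
    (C := fun i => (((unbarredRow T i).filter (b.val < ·)).map g).prod)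
    (by simpa only [rowsCount_zero] using hcount 0)
    (fun i => by
      have h₀ := hcount i
      have h₁ := hcount (i + 1)
      rw [rowsCount_succ, rowsCount_succ] at h₁
      omega)
    (fun i => (ht i).imp_right fun hi => ⟨hi.1, h.prod_transfer hg hclear hi.2⟩) (ν.colLen 0)
  simp only [hlast, add_zero, ← hprod', ← hT.prod_unbarredRow g b] at key
  simpa only [descProd_succ, unbarredRow_colLen, List.map_nil, List.prod_nil, one_mul] using key

end UnbarredRows

section Products

variable {M : Type*} [Monoid M]

theorem descProd_succ' (F : ℕ → M) (n : ℕ) :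
    descProd F (n + 1) = descProd (fun i => F (i + 1)) n * F 0 := by
  simp [descProd, List.range_succ_eq_map, Function.comp_def]

theorem prod_map_filterMap {α β : Type*} (f : α → Option β) (g : β → M) (l : List α) :
    ((l.filterMap f).map g).prod = (l.map fun x => (f x).elim 1 g).prod := by
  induction l with
  | nil => rfl
  | cons x l ih => rcases hf : f x with _ | y <;> simp [hf, ih]

theorem prod_range_mul_mul (f : ℕ → M) (e : M) (m : ℕ)
    (h : ∀ d < m, f d * e * f (d + 1) = e * f d * f (d + 1)) :
    ((List.range m).map f).prod * e * f m = e * ((List.range m).map f).prod * f m := by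
  induction m with
  | zero => simp
  | succ m ih =>
    rw [List.prod_range_succ]
    set P := ((List.range m).map f).prod
    calc P * f m * e * f (m + 1)
        = P * (f m * e * f (m + 1)) := by simp only [mul_assoc]
      _ = P * e * f m * f (m + 1) := by rw [h m m.lt_succ_self]; simp only [mul_assoc]
      _ = e * (P * f m) * f (m + 1) := by
          rw [ih fun d hd => h d (hd.trans m.lt_succ_self)]; simp only [mul_assoc]

theorem prod_range_mul (e f : ℕ → M) (L : ℕ)
    (h : ∀ d k, d < k → f d * e k * f (d + 1) = e k * f d * f (d + 1)) :
    ((List.range L).map fun k => e k * f k).prod =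
      ((List.range L).map e).prod * ((List.range L).map f).prod := by
  induction L with
  | zero => simp
  | succ L ih =>
    have hmove := prod_range_mul_mul f (e L) L fun d hd => h d L hd
    simp only [List.prod_range_succ, ih, mul_assoc] at hmove ⊢
    rw [hmove]

/-- Exchanging the two products moves `F r d` to the right of `F i k` whenever `r < i` and `d < k`;
for `i = r + 1` this may use the factor `F r (d + 1)` which follows. -/
theorem prod_range_descProd (n : ℕ) (L : ℕ) (F : ℕ → ℕ → M)
    (hfar : ∀ r i d k, r + 1 < i → d < k → Commute (F r d) (F i k))
    (hnext : ∀ r d k, d < k →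
      F r d * F (r + 1) k * F r (d + 1) = F (r + 1) k * F r d * F r (d + 1)) :
    ((List.range L).map fun k => descProd (fun i => F i k) n).prod =
      descProd (fun i => ((List.range L).map (F i)).prod) n := by
  induction n generalizing F with
  | zero => simp [descProd]
  | succ n ih =>
    simp only [descProd_succ']
    rw [prod_range_mul, ih (fun i => F (i + 1))
      (fun r i d k hri hdk => hfar (r + 1) (i + 1) d k (by omega) hdk) fun r => hnext (r + 1)]
    intro d k hdk
    cases n with
    | zero => simp [descProd]
    | succ n =>
      rw [descProd_succ']
      have hcomm : Commute (F 0 d) (descProd (fun i => F (i + 1 + 1) k) n) :=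
        Commute.list_prod_right _ _ fun y hy => by
          obtain ⟨i, -, rfl⟩ := List.mem_map.mp hy
          exact hfar 0 (i + 1 + 1) d k (by omega) hdk
      rw [← mul_assoc, hcomm.eq]
      simpa only [mul_assoc] using congrArg _ (hnext 0 d k hdk)

end Products

section Diagonals

variable {N : ℕ} {ν : YoungDiagram} {T : Filling N ν} {i k : ℕ}

theorem filterMap_range_eq_toList {α : Type*} (f : ℕ → Option α) (m j₀ : ℕ)
    (h : ∀ j, j ≠ j₀ → f j = none) (hm : m ≤ j₀ → f j₀ = none) :
    (List.range m).filterMap f = (f j₀).toList := by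
  induction m with
  | zero => simp [hm (Nat.zero_le _)]
  | succ m ih =>
    rw [List.range_succ, List.filterMap_append]
    by_cases hj : m = j₀
    · subst hj
      have hnil : (List.range m).filterMap f = [] :=
        List.filterMap_eq_nil_iff.mpr fun j hj => h j (List.mem_range.mp hj).ne
      rw [hnil]
      rcases hf : f m with _ | y <;> simp [hf]
    · rw [ih fun hle => hm (by omega)]
      simp [h m hj]

theorem diagonal_eq (ν : YoungDiagram) (k : ℕ) :
    diagonal ν k = (List.range (ν.colLen 0)).filterMap fun i =>
      if h : (i, i + k - ν.colLen 0) ∈ ν ∧ ν.colLen 0 ≤ i + k then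
        some ⟨(i, i + k - ν.colLen 0), h.1⟩ else none := by
  rw [diagonal, List.filterMap_eq_flatMap_toList (l := List.range (ν.colLen 0))]
  change List.filterMap _ (List.flatMap _ _) = _
  rw [List.filterMap_flatMap]
  refine List.flatMap_congr fun i _ => ?_
  rw [List.filterMap_map, filterMap_range_eq_toList _ _ (i + k - ν.colLen 0)]
  · congr 1
    exact dite_congr (propext (and_congr_right fun _ => by grind)) (fun _ => rfl) (fun _ => rfl)
  · exact fun j hj => dif_neg fun hc => hj (by grind)
  · exact fun hm => dif_neg fun ⟨h, _⟩ => absurd (lt_rowLen_zero h) (not_lt.mpr hm)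

/-- The number of the letter in row `i` on the `k`-th diagonal, if there is such a box and the
letter is unbarred. -/
def unbarredDiag (T : Filling N ν) (i k : ℕ) : Option ℕ :=
  if ν.colLen 0 ≤ i + k then unbarredAt T i (i + k - ν.colLen 0) else none

theorem unbarredDiag_eq_some {m : ℕ} : unbarredDiag T i k = some m ↔
    ∃ (x : Fin N) (c : ν), x.val = m ∧ T c = .unbarred x ∧ c.1.1 = i ∧
      c.1.2 + ν.colLen 0 = i + k := by
  unfold unbarredDiag
  constructor
  · intro h
    split_ifs at h with hk
    obtain ⟨x, hx, hc, hT⟩ := unbarredAt_eq_some.mp h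
    exact ⟨x, ⟨_, hc⟩, hx, hT, rfl, Nat.sub_add_cancel hk⟩
  · rintro ⟨x, ⟨⟨_, j⟩, hc⟩, hx, hT, rfl, hk⟩
    rw [if_pos (hk ▸ Nat.le_add_left _ _), ← Nat.eq_sub_of_add_eq hk]
    exact unbarredAt_eq_some.mpr ⟨x, hx, hc, hT⟩

theorem filterMap_unbarredDiag (T : Filling N ν) (hi : i ≤ ν.colLen 0) :
    (List.range (ν.colLen 0 + ν.rowLen 0)).filterMap (unbarredDiag T i) = unbarredRow T i := by
  have hsplit : ν.colLen 0 + ν.rowLen 0 = (ν.colLen 0 - i) + (ν.rowLen 0 + i) := by omega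
  have hbefore : (List.range (ν.colLen 0 - i)).filterMap (unbarredDiag T i) = [] :=
    List.filterMap_eq_nil_iff.mpr fun k hk => if_neg (by have := List.mem_range.mp hk; omega)
  have hrow (j : ℕ) : unbarredDiag T i (ν.colLen 0 - i + j) = unbarredAt T i j := by
    rw [unbarredDiag, if_pos (by omega), show i + (ν.colLen 0 - i + j) - ν.colLen 0 = j by omega]
  have hafter (j : ℕ) : unbarredAt T i (ν.rowLen 0 + j) = none :=
    dif_neg fun h => (lt_rowLen_zero h).not_ge (Nat.le_add_right _ _)
  rw [hsplit, List.range_add, List.filterMap_append, hbefore, List.nil_append, List.filterMap_map,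
    List.range_add, List.filterMap_append, List.filterMap_map]
  simp [Function.comp_def, hrow, hafter, unbarredRow]

/-- The numbers of the unbarred letters of a colored word. -/
def unbarredWord (w : Word N) : List ℕ :=
  w.filterMap Letter.unbarred?

theorem unbarredWord_diagonalWord (T : Filling N ν) (k : ℕ) :
    unbarredWord (diagonalWord T k) =
      (diagonal ν k).reverse.filterMap fun c => (T c).unbarred? := by
  have hunbarred (x : Letter N) :
      (if x.isBarred = false then x.unbarred? else none) = x.unbarred? := by
    cases x <;> rfl
  have hbarred (x : Letter N) : (if x.isBarred = true then x.unbarred? else none) = none := by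
    cases x <;> rfl
  simp [unbarredWord, diagonalWord, List.filterMap_filter, hunbarred, hbarred]

theorem unbarredWord_diagonalWord_eq_rows (T : Filling N ν) (k : ℕ) :
    unbarredWord (diagonalWord T k) =
      (List.range (ν.colLen 0)).reverse.filterMap fun i => unbarredDiag T i k := by
  rw [unbarredWord_diagonalWord, diagonal_eq, ← List.filterMap_reverse, List.filterMap_filterMap]
  refine List.filterMap_congr fun i _ => ?_
  unfold unbarredDiag unbarredAt
  by_cases h₁ : ν.colLen 0 ≤ i + k <;> by_cases h₂ : (i, i + k - ν.colLen 0) ∈ ν <;> simp [h₁, h₂]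

end Diagonals

section Reading

variable {N : ℕ} {ν : YoungDiagram} {o o' : ShuffleOrder N} {T T' : Filling N ν} {x y : Fin N}
  {c d : ν} {M : Type*} [Monoid M] {g : ℕ → M}

theorem ShuffleOrder.exists_barred_of_between (hxy : x.val + 1 = y.val) {l : Letter N}
    (hx : o.lt (.unbarred x) l) (hy : o.lt l (.unbarred y)) : ∃ e, l = .barred e := by
  rcases l with e | e
  · rw [o.unbarred_lt_unbarred] at hx hy
    omega
  · exact ⟨e, rfl⟩

theorem SparseBarred.not_lt_of_lt (ho : SparseBarred o) (hT : IsColored o T)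
    (hxy : x.val + 1 = y.val) (h₁ : c.1.1 = d.1.1) (h₂ : c.1.2 < d.1.2)
    (hx : o.lt (.unbarred x) (T c)) : ¬ o.lt (T d) (.unbarred y) := by
  intro hy
  have hcd : o.rank (T c) ≤ o.rank (T d) := (hT.row h₁ h₂).rank_le
  have hx' : o.lt (.unbarred x) (T d) :=
    o.lt_iff_rank_lt.mpr ((o.rank_lt_rank hx).trans_le hcd)
  have hy' : o.lt (T c) (.unbarred y) :=
    o.lt_iff_rank_lt.mpr (hcd.trans_lt (o.rank_lt_rank hy))
  obtain ⟨e, he⟩ := o.exists_barred_of_between hxy hx hy'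
  obtain ⟨e', he'⟩ := o.exists_barred_of_between hxy hx' hy
  have hlt := hT.lt_of_row h₁ h₂ (.inl he)
  rw [he] at hx hy' hlt
  rw [he'] at hx' hy hlt
  rw [ho x y e e' hxy hx (o.asymm hy') hx' (o.asymm hy)] at hlt
  exact o.irrefl _ hlt

theorem IsColored.lt_unbarred_of_lt (hT : IsColored o T) (h₁ : c.1.1 < d.1.1)
    (h₂ : c.1.2 ≤ d.1.2) (hd : T d = .unbarred y) : o.lt (T c) (.unbarred y) := by
  let m : ν := ⟨(c.1.1, d.1.2), ν.up_left_mem h₁.le le_rfl d.2⟩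
  have hcm : o.rank (T c) ≤ o.rank (T m) := hT.rank_mono (Prod.mk_le_mk.mpr ⟨le_rfl, h₂⟩)
  have hmd : o.lt (T m) (T d) := hT.lt_of_col (c := m) rfl h₁ (.inr hd)
  exact hd ▸ o.lt_iff_rank_lt.mpr (hcm.trans_lt (o.rank_lt_rank hmd))

theorem SparseBarred.unbarred_of_southeast (ho : SparseBarred o) (hT : IsColored o T)
    (hc : T c = .unbarred x) (hd : T d = .unbarred y) (h₁ : c.1.1 < d.1.1)
    (h₂ : c.1.2 + d.1.1 < d.1.2 + c.1.1) :
    x.val + 2 ≤ y.val ∨ y.val = x.val + 1 ∧ d.1.1 = c.1.1 + 1 ∧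
      ∃ m : ν, m.1.1 = c.1.1 ∧ m.1.2 = c.1.2 + 1 ∧ T m = .unbarred x := by
  have box (i j : ℕ) (hi : i < d.1.1) (hj : j ≤ d.1.2) :
      ∃ m : ν, m.1 = (i, j) ∧ o.lt (T m) (.unbarred y) :=
    ⟨⟨(i, j), ν.up_left_mem hi.le hj d.2⟩, rfl, hT.lt_unbarred_of_lt hi hj hd⟩
  have hxy := hT.lt_unbarred_of_lt h₁ (by omega) hd
  rw [hc, o.unbarred_lt_unbarred, Fin.lt_def] at hxy
  refine or_iff_not_imp_left.mpr fun hnear => ?_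
  have hyx : x.val + 1 = y.val := by omega
  obtain ⟨m₁, hm₁, -⟩ := box c.1.1 (c.1.2 + 1) h₁ (by omega)
  obtain ⟨m₂, hm₂, hm₂y⟩ := box c.1.1 (c.1.2 + 2) h₁ (by omega)
  have hm₁x : T m₁ = .unbarred x := by
    rcases hT.row_weak c m₁ (by rw [hm₁]) (by rw [hm₁]; exact Nat.lt_succ_self _) with h | h
    · exact h.symm.trans hc
    · exact absurd hm₂y (ho.not_lt_of_lt hT hyx (by rw [hm₁, hm₂]) (by simp [hm₁, hm₂]) (hc ▸ h))
  refine ⟨hyx.symm, ?_, m₁, by rw [hm₁], by rw [hm₁], hm₁x⟩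
  by_contra hne
  obtain ⟨n₁, hn₁, -⟩ := box (c.1.1 + 1) (c.1.2 + 1) (by omega) (by omega)
  obtain ⟨n₂, hn₂, hn₂y⟩ := box (c.1.1 + 1) (c.1.2 + 2) (by omega) (by omega)
  have hxn₁ : o.lt (T m₁) (T n₁) :=
    hT.lt_of_col (by rw [hm₁, hn₁]) (by simp [hm₁, hn₁]) (.inl hm₁x)
  exact ho.not_lt_of_lt hT hyx (by rw [hn₁, hn₂]) (by simp [hn₁, hn₂]) (hm₁x ▸ hxn₁) hn₂y

theorem SparseBarred.unbarredDiag_of_lt (ho : SparseBarred o) (hT : IsColored o T)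
    {r i d k m n : ℕ} (hri : r < i) (hdk : d < k) (hm : unbarredDiag T r d = some m)
    (hn : unbarredDiag T i k = some n) :
    m + 2 ≤ n ∨ n = m + 1 ∧ i = r + 1 ∧ unbarredDiag T r (d + 1) = some m := by
  obtain ⟨x, c, rfl, hx, rfl, hc⟩ := unbarredDiag_eq_some.mp hm
  obtain ⟨y, e, rfl, hy, rfl, he⟩ := unbarredDiag_eq_some.mp hn
  refine (ho.unbarred_of_southeast hT hx hy hri (by omega)).imp_right ?_
  rintro ⟨hxy, hrow, c', hc'₁, hc'₂, hx'⟩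
  exact ⟨hxy, hrow, unbarredDiag_eq_some.mpr ⟨x, c', rfl, hx', hc'₁, by omega⟩⟩

theorem prod_unbarredWord_sqread_eq_descProd (hg : LocalPlactic g) (hT : IsColored o T)
    (ho : SparseBarred o) :
    ((unbarredWord (sqread T)).map g).prod =
      descProd (fun i => ((unbarredRow T i).map g).prod) (ν.colLen 0) := by
  let F (i k : ℕ) : M := (unbarredDiag T i k).elim 1 g
  have hdiag (k : ℕ) : ((unbarredWord (diagonalWord T k)).map g).prod =
      descProd (fun i => F i k) (ν.colLen 0) := by
    rw [unbarredWord_diagonalWord_eq_rows, prod_map_filterMap, descProd]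
  have hrow (i : ℕ) (hi : i < ν.colLen 0) :
      ((List.range (ν.colLen 0 + ν.rowLen 0)).map (F i)).prod = ((unbarredRow T i).map g).prod := by
    rw [← filterMap_unbarredDiag T hi.le, prod_map_filterMap]
  have hfar (r i d k : ℕ) (hri : r + 1 < i) (hdk : d < k) : Commute (F r d) (F i k) := by
    rcases hm : unbarredDiag T r d with _ | m
    · simp [F, hm]
    rcases hn : unbarredDiag T i k with _ | n
    · simp [F, hn]
    rcases ho.unbarredDiag_of_lt hT (by omega) hdk hm hn with h | ⟨-, h, -⟩
    · simpa [F, hm, hn] using hg.commute (.inl h)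
    · omega
  have hnext (r d k : ℕ) (hdk : d < k) :
      F r d * F (r + 1) k * F r (d + 1) = F (r + 1) k * F r d * F r (d + 1) := by
    rcases hm : unbarredDiag T r d with _ | m
    · simp [F, hm]
    rcases hn : unbarredDiag T (r + 1) k with _ | n
    · simp [F, hn]
    rcases ho.unbarredDiag_of_lt hT r.lt_succ_self hdk hm hn with h | ⟨rfl, -, h⟩
    · simp [F, hm, hn, (hg.commute (.inl h)).eq]
    · simpa [F, hm, hn, h] using (hg.zyy m).symm
  calc ((unbarredWord (sqread T)).map g).prod
      = ((List.range (ν.colLen 0 + ν.rowLen 0)).map fun k =>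
          descProd (fun i => F i k) (ν.colLen 0)).prod := by
        simp only [← hdiag, unbarredWord, sqread]
        simp [List.flatMap, List.prod_flatten, Function.comp_def]
    _ = descProd (fun i => ((unbarredRow T i).map g).prod) (ν.colLen 0) := by
        rw [prod_range_descProd _ _ F hfar hnext, descProd, descProd]
        exact congrArg List.prod (List.map_congr_left fun i hi => hrow i (by simpa using hi))

theorem prod_unbarredWord_sqread_eq (hg : LocalPlactic g) (hT : IsColored o T)
    (hT' : IsColored o' T') (ho : SparseBarred o) (ho' : SparseBarred o')
    (h : ReflTransGen (fun p q : ShuffleOrder N × Filling N ν =>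
      DownStep p q ∧ ClearSwap p.1 q.1) (o, T) (o', T')) :
    ((unbarredWord (sqread T)).map g).prod = ((unbarredWord (sqread T')).map g).prod := by
  rw [prod_unbarredWord_sqread_eq_descProd hg hT ho,
    prod_unbarredWord_sqread_eq_descProd hg hT' ho']
  let rows (p : ShuffleOrder N × Filling N ν) : M :=
    descProd (fun i => ((unbarredRow p.2 i).map g).prod) (ν.colLen 0)
  have hstep (p q : ShuffleOrder N × Filling N ν) (h : DownStep p q ∧ ClearSwap p.1 q.1) :
      rows p = rows q := by
    obtain ⟨⟨b, a, hs⟩, b', a', hswap, hclear⟩ := h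
    have hb : b = b' := by
      by_contra hne
      exact q.1.asymm hswap.2.1
        (hs.1.unbarred_lt_barred_iff.mpr ⟨hswap.1, fun e => hne e.1.symm⟩)
    exact hs.descProd_unbarredRow_eq hg (hb ▸ hclear)
  exact h.trans_induction_on (motive := fun {p q} _ => rows p = rows q) (fun _ => rfl)
    (hstep _ _) fun _ _ => Eq.trans

end Reading

section TransposedReading

variable {N : ℕ} {ν : YoungDiagram} {o o' : ShuffleOrder N} {T T' : Filling N ν} {k : ℕ}

theorem mem_diagonal {c : ν} : c ∈ diagonal ν k ↔ c.1.2 + ν.colLen 0 = c.1.1 + k := by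
  rw [diagonal, List.mem_filterMap]
  constructor
  · rintro ⟨d, -, h⟩
    split_ifs at h with hd
    cases h
    exact hd.2
  · exact fun h => ⟨c.1, List.mem_product.mpr ⟨List.mem_range.mpr (lt_colLen_zero c.2),
      List.mem_range.mpr (lt_rowLen_zero c.2)⟩, dif_pos ⟨c.2, h⟩⟩

theorem diagonal_pairwise (ν : YoungDiagram) (k : ℕ) :
    (diagonal ν k).Pairwise fun c d => c.1.1 < d.1.1 := by
  rw [diagonal_eq, List.pairwise_filterMap]
  refine List.pairwise_lt_range.imp fun {i j} hij c hc d hd => ?_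
  split_ifs at hc hd
  cases hc
  cases hd
  exact hij

theorem map_diagonal_transpose (hk : k ≤ ν.colLen 0 + ν.rowLen 0) :
    (diagonal ν.transpose k).map (transposeBox ν) = diagonal ν (ν.colLen 0 + ν.rowLen 0 - k) := by
  have hmem (c : ν.transpose) : c ∈ diagonal ν.transpose k ↔
      transposeBox ν c ∈ diagonal ν (ν.colLen 0 + ν.rowLen 0 - k) := by
    rw [mem_diagonal, mem_diagonal, YoungDiagram.colLen_transpose]
    change c.1.2 + _ = c.1.1 + k ↔ c.1.1 + _ = c.1.2 + _
    omega
  let r : ν → ν → Prop := fun c d => c.1.1 < d.1.1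
  have : Std.Irrefl r := ⟨fun c => lt_irrefl _⟩
  have : Std.Antisymm r := ⟨fun c d h h' => absurd h' (lt_asymm h)⟩
  refine List.Pairwise.eq_of_mem_iff (r := r) ?_ (diagonal_pairwise ν _) fun c => ?_
  · refine List.pairwise_map.mpr ((diagonal_pairwise ν.transpose k).imp_of_mem ?_)
    intro c d hc hd h
    rw [mem_diagonal] at hc hd
    change c.1.2 < d.1.2
    omega
  · rw [List.mem_map]
    constructor
    · rintro ⟨d, hd, rfl⟩
      exact (hmem d).mp hd
    · exact fun hc => ⟨(transposeBox ν).symm c, (hmem _).mpr (by simpa using hc), by simp⟩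

theorem diagonal_zero (ν : YoungDiagram) : diagonal ν 0 = [] :=
  List.eq_nil_iff_forall_not_mem.mpr fun c hc => by
    have := mem_diagonal.mp hc
    have := lt_colLen_zero (i := c.1.1) (j := c.1.2) c.2
    omega

theorem diagonal_colLen_add_rowLen (ν : YoungDiagram) :
    diagonal ν (ν.colLen 0 + ν.rowLen 0) = [] :=
  List.eq_nil_iff_forall_not_mem.mpr fun c hc => by
    have := mem_diagonal.mp hc
    have := lt_rowLen_zero (i := c.1.1) (j := c.1.2) c.2
    omega

theorem flatMap_range_sub {α : Type*} (D : ℕ → List α) (L : ℕ) (h₀ : D 0 = []) (hL : D L = []) :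
    ((List.range L).flatMap fun k => D (L - k)) = (List.range L).reverse.flatMap D := by
  have hreverse : (List.range (L + 1)).reverse.flatMap D =
      (List.range (L + 1)).flatMap fun k => D (L - k) := by
    rw [List.range_eq_range', List.reverse_range', ← List.range_eq_range', List.flatMap_map]
    simp
  simpa [List.range_succ, h₀, hL] using hreverse.symm

/-- The numbers of the barred letters of a colored word. -/
def barredWord (w : Word N) : List ℕ :=
  unbarredWord (w.map Letter.flip)

theorem barredWord_diagonalWord (T : Filling N ν) (k : ℕ) :
    barredWord (diagonalWord T k) = (diagonal ν k).filterMap fun c => (T c).flip.unbarred? := by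
  have hunbarred (x : Letter N) :
      (if x.isBarred = false then x.flip.unbarred? else none) = none := by
    cases x <;> rfl
  have hbarred (x : Letter N) :
      (if x.isBarred = true then x.flip.unbarred? else none) = x.flip.unbarred? := by
    cases x <;> rfl
  simp [barredWord, unbarredWord, diagonalWord, List.filterMap_filter, hunbarred, hbarred]

theorem unbarredWord_diagonalWord_transposeFilling (T : Filling N ν)
    (hk : k ≤ ν.colLen 0 + ν.rowLen 0) :
    unbarredWord (diagonalWord (transposeFilling T) k) =
      (barredWord (diagonalWord T (ν.colLen 0 + ν.rowLen 0 - k))).reverse := by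
  rw [unbarredWord_diagonalWord, barredWord_diagonalWord, ← map_diagonal_transpose hk,
    List.filterMap_map, List.filterMap_reverse]
  rfl

theorem unbarredWord_sqread_transposeFilling (T : Filling N ν) :
    unbarredWord (sqread (transposeFilling T)) = (barredWord (sqread T)).reverse := by
  set L := ν.colLen 0 + ν.rowLen 0
  let D (k : ℕ) : List ℕ := (barredWord (diagonalWord T k)).reverse
  have h₀ : D 0 = [] := by simp [D, barredWord_diagonalWord, diagonal_zero]
  have h₁ : D L = [] := by simp [D, L, barredWord_diagonalWord, diagonal_colLen_add_rowLen]
  calc unbarredWord (sqread (transposeFilling T))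
      = (List.range L).flatMap fun k => unbarredWord (diagonalWord (transposeFilling T) k) := by
        rw [sqread, YoungDiagram.colLen_transpose, YoungDiagram.rowLen_transpose, add_comm]
        exact List.filterMap_flatMap
    _ = (List.range L).flatMap fun k => D (L - k) :=
        List.flatMap_congr fun k hk =>
          unbarredWord_diagonalWord_transposeFilling T (List.mem_range.mp hk).le
    _ = (List.range L).reverse.flatMap D := flatMap_range_sub D L h₀ h₁
    _ = (barredWord (sqread T)).reverse := by
        rw [sqread, barredWord, List.map_flatMap, unbarredWord, List.filterMap_flatMap,
          List.reverse_flatMap]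
        rfl

variable {M : Type*} [Monoid M] {g : ℕ → M}

theorem op_prod_barredWord_sqread (g : ℕ → M) (T : Filling N ν) :
    op ((barredWord (sqread T)).map g).prod =
      ((unbarredWord (sqread (transposeFilling T))).map fun n => op (g n)).prod := by
  rw [op_list_prod, unbarredWord_sqread_transposeFilling, List.map_map, List.map_reverse]
  rfl

theorem prod_barredWord_sqread_eq (hg : LocalPlactic fun n => op (g n)) (hT : IsColored o T)
    (hT' : IsColored o' T') (ho : SparseBarred o.flip) (ho' : SparseBarred o'.flip)
    (h : ReflTransGen (fun p q : ShuffleOrder N × Filling N ν =>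
      DownStep p q ∧ ClearSwap q.1.flip p.1.flip) (o, T) (o', T')) :
    ((barredWord (sqread T)).map g).prod = ((barredWord (sqread T')).map g).prod := by
  have htranspose : ReflTransGen (fun p q : ShuffleOrder N × Filling N ν.transpose =>
      DownStep p q ∧ ClearSwap p.1 q.1)
      (o'.flip, transposeFilling T') (o.flip, transposeFilling T) := by
    refine ReflTransGen.lift (fun p => (p.1.flip, transposeFilling p.2)) ?_ _ _ h.swap
    rintro p q ⟨⟨b, a, hswap, hq, hp, hR⟩, hclear⟩
    exact ⟨⟨a, b, hswap.flip, isColored_transposeFilling.mpr hp, isColored_transposeFilling.mpr hq,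
      refills_transposeFilling.mpr hR.symm⟩, hclear⟩
  apply op_injective
  rw [op_prod_barredWord_sqread, op_prod_barredWord_sqread]
  exact (prod_unbarredWord_sqread_eq hg (isColored_transposeFilling.mpr hT')
    (isColored_transposeFilling.mpr hT) ho' ho htranspose).symm

end TransposedReading

section SyntacticMonoid

variable {α : Type*} {W : Set (List α)}

/-- The syntactic congruence of a set `W` of words: two words are congruent when replacing one by
the other, in any context, does not affect membership in `W`. -/
def syntacticCon (W : Set (List α)) : Con (FreeMonoid α) where
  r x y := ∀ p s : FreeMonoid α, (p * x * s).toList ∈ W ↔ (p * y * s).toList ∈ W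
  iseqv := ⟨fun _ _ _ => Iff.rfl, fun h p s => (h p s).symm, fun h h' p s => (h p s).trans (h' p s)⟩
  mul' {w x y z} hwx hyz p s := by
    have hw := hwx p (y * s)
    have hy := hyz (p * x) s
    simp only [mul_assoc] at hw hy ⊢
    exact hw.trans hy

theorem syntacticCon_iff {x y : FreeMonoid α} : syntacticCon W x y ↔
    ∀ p s : FreeMonoid α, (p * x * s).toList ∈ W ↔ (p * y * s).toList ∈ W := Iff.rfl

/-- The class of a letter in the syntactic monoid of `W`. -/
def letterClass (W : Set (List α)) (x : α) : (syntacticCon W).Quotient :=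
  (FreeMonoid.of x : FreeMonoid α)

theorem prod_letterClass (w : List α) : (w.map (letterClass W)).prod =
    ((FreeMonoid.ofList w : FreeMonoid α) : (syntacticCon W).Quotient) := by
  induction w with
  | nil => rfl
  | cons x w ih => rw [List.map_cons, List.prod_cons, ih, FreeMonoid.ofList_cons]; rfl

theorem prod_letterClass_eq_iff {w w' : List α} :
    (w.map (letterClass W)).prod = (w'.map (letterClass W)).prod ↔
      syntacticCon W (FreeMonoid.ofList w) (FreeMonoid.ofList w') := by
  rw [prod_letterClass, prod_letterClass, Con.eq]

theorem mem_iff_of_prod_letterClass_eq {w w' : List α}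
    (h : (w.map (letterClass W)).prod = (w'.map (letterClass W)).prod) : w ∈ W ↔ w' ∈ W := by
  simpa using syntacticCon_iff.mp (prod_letterClass_eq_iff.mp h) 1 1

end SyntacticMonoid

section KroneckerRelations

variable {N : ℕ} {W : Set (Word N)}

theorem ShuffleClosed.commute_letterClass (hW : ShuffleClosed W) {x y : Letter N}
    (hxy : x.isBarred ≠ y.isBarred) : Commute (letterClass W x) (letterClass W y) := by
  have h : syntacticCon W (FreeMonoid.ofList [x, y]) (FreeMonoid.ofList [y, x]) := fun p s =>
    ⟨hW p.toList s.toList x y hxy, hW p.toList s.toList y x hxy.symm⟩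
  simpa [Commute, SemiconjBy] using prod_letterClass_eq_iff.mpr h

theorem pairing_of_sub_of (γ : Word N → ℤ) (x y : FreeMonoid (Letter N)) :
    pairing γ (MonoidAlgebra.of ℤ _ x - MonoidAlgebra.of ℤ _ y) = γ x.toList - γ y.toList := by
  rw [pairing, MonoidAlgebra.coeff_sub, Finsupp.sum_sub_index fun _ _ _ => mul_sub _ _ _]
  simp [MonoidAlgebra.of, MonoidAlgebra.coeff_single]

theorem syntacticCon_of_kronRelator (hW : indicatorSum W ∈ perp (Ikron N))
    {x y : FreeMonoid (Letter N)}
    (h : KronRelator (MonoidAlgebra.of ℤ _ x - MonoidAlgebra.of ℤ _ y)) : syntacticCon W x y := by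
  refine syntacticCon_iff.mpr fun p s => ?_
  have hmem : MonoidAlgebra.of ℤ _ p * (MonoidAlgebra.of ℤ _ x - MonoidAlgebra.of ℤ _ y) *
      MonoidAlgebra.of ℤ _ s ∈ Ikron N :=
    TwoSidedIdeal.mul_mem_right _ _ _ <|
      TwoSidedIdeal.mul_mem_left _ _ _ (TwoSidedIdeal.subset_span h)
  rw [mul_sub, sub_mul, ← map_mul, ← map_mul, ← map_mul, ← map_mul] at hmem
  have hpair := sub_eq_zero.mp ((pairing_of_sub_of _ _ _).symm.trans (hW _ hmem))
  rw [indicatorSum] at hpair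
  rw [← Set.indicator_eq_one_iff_mem ℤ, hpair, Set.indicator_eq_one_iff_mem]

theorem letterClass_mul_mul_eq (hW : indicatorSum W ∈ perp (Ikron N)) {x y z x' y' z' : Letter N}
    (h : KronRelator (u x * u y * u z - u x' * u y' * u z')) :
    letterClass W x * letterClass W y * letterClass W z =
      letterClass W x' * letterClass W y' * letterClass W z' :=
  (Con.eq _).mpr (syntacticCon_of_kronRelator hW (by simpa only [map_mul, u] using h))

theorem letterClass_mul_eq (hW : indicatorSum W ∈ perp (Ikron N)) {x y x' y' : Letter N}
    (h : KronRelator (u x * u y - u x' * u y')) :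
    letterClass W x * letterClass W y = letterClass W x' * letterClass W y' :=
  (Con.eq _).mpr (syntacticCon_of_kronRelator hW (by simpa only [map_mul, u] using h))

/-- The class of the `n`-th unbarred letter in the syntactic monoid of `W`, with value `1` for
`N ≤ n`. -/
def unbarredClass (W : Set (Word N)) (n : ℕ) : (syntacticCon W).Quotient :=
  if h : n < N then letterClass W (.unbarred ⟨n, h⟩) else 1

/-- The class of the `n`-th barred letter in the syntactic monoid of `W`, with value `1` for
`N ≤ n`. -/
def barredClass (W : Set (Word N)) (n : ℕ) : (syntacticCon W).Quotient :=
  if h : n < N then letterClass W (.barred ⟨n, h⟩) else 1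

theorem localPlactic_unbarredClass (hW : indicatorSum W ∈ perp (Ikron N)) :
    LocalPlactic (unbarredClass W) where
  comm x z hxz := by
    by_cases hz : z < N
    · have hx : x < N := by omega
      simp only [unbarredClass, dif_pos hx, dif_pos hz]
      refine letterClass_mul_eq hW (.farCommute _ _ (.unbarred ⟨z - 1, by omega⟩) ?_ ?_)
      · simp [down₂, down, show z ≠ 0 by omega]
      · simp only [natOrder, natRank]
        omega
    · simp [unbarredClass, hz]
  yyx x := by
    by_cases hy : x + 1 < N
    · simp only [unbarredClass, dif_pos hy, dif_pos (x.lt_succ_self.trans hy)]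
      exact letterClass_mul_mul_eq hW (.yyx _ _ rfl ((natOrder N).unbarred_lt _ _ x.lt_succ_self))
    · simp [unbarredClass, hy]
  zyy y := by
    by_cases hz : y + 1 < N
    · simp only [unbarredClass, dif_pos hz, dif_pos (y.lt_succ_self.trans hz)]
      exact letterClass_mul_mul_eq hW (.zyy _ _ rfl ((natOrder N).unbarred_lt _ _ y.lt_succ_self))
    · simp [unbarredClass, hz]

theorem localPlactic_barredClass (hW : indicatorSum W ∈ perp (Ikron N)) :
    LocalPlactic fun n => op (barredClass W n) where
  comm x z hxz := by
    rw [← op_mul, ← op_mul, op_inj]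
    by_cases hz : z < N
    · have hx : x < N := by omega
      simp only [barredClass, dif_pos hx, dif_pos hz]
      refine (letterClass_mul_eq hW (.farCommute _ _ (.barred ⟨z - 1, by omega⟩) ?_ ?_)).symm
      · simp [down₂, down, show z ≠ 0 by omega]
      · simp only [natOrder, natRank]
        omega
    · simp [barredClass, hz]
  yyx x := by
    simp only [← op_mul, op_inj, ← mul_assoc]
    by_cases hy : x + 1 < N
    · simp only [barredClass, dif_pos hy, dif_pos (x.lt_succ_self.trans hy)]
      exact letterClass_mul_mul_eq hW (.xyy _ _ rfl ((natOrder N).barred_lt _ _ x.lt_succ_self))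
    · simp [barredClass, hy]
  zyy y := by
    simp only [← op_mul, op_inj, ← mul_assoc]
    by_cases hz : y + 1 < N
    · simp only [barredClass, dif_pos hz, dif_pos (y.lt_succ_self.trans hz)]
      exact letterClass_mul_mul_eq hW (.yyz _ _ rfl ((natOrder N).barred_lt _ _ y.lt_succ_self))
    · simp [barredClass, hz]

theorem ShuffleClosed.commute_barred_prod_unbarredClass (hW : ShuffleClosed W) (a : Fin N)
    (l : List ℕ) : Commute (letterClass W (.barred a)) (l.map (unbarredClass W)).prod := by
  refine Commute.list_prod_right _ _ fun y hy => ?_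
  obtain ⟨n, -, rfl⟩ := List.mem_map.mp hy
  by_cases hn : n < N
  · simpa [unbarredClass, hn] using hW.commute_letterClass (by simp [Letter.isBarred])
  · simp [unbarredClass, hn]

theorem ShuffleClosed.prod_letterClass_eq (hW : ShuffleClosed W) (w : Word N) :
    (w.map (letterClass W)).prod = ((unbarredWord w).map (unbarredClass W)).prod *
      ((barredWord w).map (barredClass W)).prod := by
  induction w with
  | nil => exact (mul_one 1).symm
  | cons x w ih =>
    rw [List.map_cons, List.prod_cons, ih]
    cases x with
    | unbarred b =>
      simp [unbarredWord, barredWord, List.filterMap_cons, Letter.unbarred?, Letter.flip,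
        unbarredClass, mul_assoc]
    | barred a =>
      have hcomm := (hW.commute_barred_prod_unbarredClass a (unbarredWord w)).left_comm
        ((barredWord w).map (barredClass W)).prod
      simpa [unbarredWord, barredWord, List.filterMap_cons, Letter.unbarred?, Letter.flip,
        barredClass] using hcomm

end KroneckerRelations

section Conversion

variable {N : ℕ} {ν : YoungDiagram} {W : Set (Word N)} {T T' : Filling N ν}

theorem exists_convertsTo (hT : IsColored (bigBarOrder N) T) :
    ∃ T', IsColored (natOrder N) T' ∧ ConvertsTo (bigBarOrder N) (natOrder N) T T' := by
  obtain ⟨T', hT', h⟩ :=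
    exists_downSteps (fun _ _ h => h) (reflTransGen_differBySwap (natOrder N)) hT
  exact ⟨T', hT', convertsTo_of_downSteps (ReflTransGen.mono (fun _ _ h => h.1) _ _ h)⟩

theorem exists_convertsTo_symm (hT' : IsColored (natOrder N) T') :
    ∃ T, IsColored (bigBarOrder N) T ∧ ConvertsTo (bigBarOrder N) (natOrder N) T T' := by
  obtain ⟨T, hT, h⟩ := exists_downSteps_symm (reflTransGen_differBySwap (natOrder N)) hT'
  exact ⟨T, hT, convertsTo_of_downSteps h⟩

theorem downSteps_along {r : ShuffleOrder N → ShuffleOrder N → Prop}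
    (hr : ∀ o o', r o o' → ∃ b a, DifferBySwap o o' b a)
    (hchain : ReflTransGen r (bigBarOrder N) (natOrder N)) (hT : IsColored (bigBarOrder N) T)
    (h : ConvertsTo (bigBarOrder N) (natOrder N) T T') :
    ReflTransGen (fun p q : ShuffleOrder N × Filling N ν => DownStep p q ∧ r p.1 q.1)
      (bigBarOrder N, T) (natOrder N, T') := by
  obtain ⟨T₁, -, hsteps⟩ := exists_downSteps hr hchain hT
  have hconv := convertsTo_of_downSteps (ReflTransGen.mono (fun _ _ h => h.1) _ _ hsteps)
  rwa [convertsTo_unique hT hconv h] at hsteps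

theorem isColored_of_convertsTo (hT : IsColored (bigBarOrder N) T)
    (h : ConvertsTo (bigBarOrder N) (natOrder N) T T') : IsColored (natOrder N) T' := by
  obtain ⟨T₁, hT₁, h₁⟩ := exists_convertsTo hT
  rwa [convertsTo_unique hT h h₁]

theorem sqread_mem_iff (hW : ShuffleClosed W) (hperp : indicatorSum W ∈ perp (Ikron N))
    (hT : IsColored (bigBarOrder N) T) (h : ConvertsTo (bigBarOrder N) (natOrder N) T T') :
    sqread T ∈ W ↔ sqread T' ∈ W := by
  have hT' := isColored_of_convertsTo hT h
  apply mem_iff_of_prod_letterClass_eq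
  rw [hW.prod_letterClass_eq, hW.prod_letterClass_eq]
  congr 1
  · exact prod_unbarredWord_sqread_eq (localPlactic_unbarredClass hperp) hT hT'
      sparseBarred_bigBarOrder sparseBarred_natOrder
      (downSteps_along (fun _ _ h => h.differBySwap) reflTransGen_clearSwap hT h)
  · exact prod_barredWord_sqread_eq (localPlactic_barredClass hperp) hT hT'
      sparseBarred_flip_bigBarOrder sparseBarred_flip_natOrder
      (downSteps_along (fun _ _ h => h.differBySwap_of_flip) reflTransGen_clearSwap_flip hT h)

end Conversion

end ColoredTableaux

/-- Conversion from `≺`-colored tableaux to `<`-colored tableaux is well defined (independent of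
the sequence of swaps), and it maps `{T ∈ CT_ν^≺ ∣ sqread(T) ∈ W}` onto
`{T ∈ CT_ν^< ∣ sqread(T) ∈ W}`. -/
theorem theorem3p10 (N : ℕ) (ν : YoungDiagram) (W : Set (ColoredTableaux.Word N))
    (hshuffle : ColoredTableaux.ShuffleClosed W)
    (hperp : ColoredTableaux.indicatorSum W ∈ ColoredTableaux.perp (ColoredTableaux.Ikron N)) :
    (∀ T ∈ ColoredTableaux.CT (ColoredTableaux.bigBarOrder N) ν,
      ∃! T' : ColoredTableaux.Filling N ν,
        ColoredTableaux.ConvertsTo (ColoredTableaux.bigBarOrder N) (ColoredTableaux.natOrder N)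
          T T') ∧
    {T' : ColoredTableaux.Filling N ν |
        ∃ T ∈ ColoredTableaux.CT (ColoredTableaux.bigBarOrder N) ν,
          ColoredTableaux.sqread T ∈ W ∧
          ColoredTableaux.ConvertsTo (ColoredTableaux.bigBarOrder N) (ColoredTableaux.natOrder N)
            T T'} =
      {T' ∈ ColoredTableaux.CT (ColoredTableaux.natOrder N) ν |
        ColoredTableaux.sqread T' ∈ W} := by
  refine ⟨fun T hT => ?_, Set.ext fun T' => ⟨?_, ?_⟩⟩
  · obtain ⟨T', -, h⟩ := ColoredTableaux.exists_convertsTo hT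
    exact ⟨T', h, fun T'' h' => ColoredTableaux.convertsTo_unique hT h' h⟩
  · rintro ⟨T, hT, hTW, h⟩
    exact ⟨ColoredTableaux.isColored_of_convertsTo hT h,
      (ColoredTableaux.sqread_mem_iff hshuffle hperp hT h).mp hTW⟩
  · rintro ⟨hT', hTW⟩
    obtain ⟨T, hT, h⟩ := ColoredTableaux.exists_convertsTo_symm hT'
    exact ⟨T, hT, (ColoredTableaux.sqread_mem_iff hshuffle hperp hT h).mpr hTW, h⟩
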